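/- **Setting.** Let $\mathcal G=(V,E)$ be a finite simple graph with nonempty sets $I,O\subseteq V$ of input and output nodes (which may intersect), and let $(f,\prec)$ be a flow: $\prec$ is a strict partial order on $V$ and $f:V\setminus O\to V\setminus I$ satisfies, for all $j\in V\setminus O$: $(j,f(j))\in E$; $j\prec f(j)$; and $j\prec k$ for every $k\in N(f(j))\setminus\{j\}$. Let $<$ be a total order on $V$ extending $\prec$. Let $V=V_{\mathcal A}\sqcup V_{\mathcal O}$ (Alice's and Oscar's nodes) with $I,O\subseteq V_{\mathcal A}$, let $b\in\mathbb N$ and $\Omega=\{\pi k/2^{b-1}:0\le k<2^b\}$. All of this is public. Alice has private angles $\phi_i\in\Omega$ ($i\in V_{\mathcal A}\setminus O$) and an input state $\rho$ on the qubits $I$; Oscar has private angles $\psi_i\in\Omega$ ($i\in V_{\mathcal O}$). Write $\theta=\phi\cup\psi$, $|+_\theta\rangle=(|0\rangle+e^{i\theta}|1\rangle)/\sqrt2$, $|\pm_\theta\rangle$ for the basis $|+_\theta\rangle,|+_{\theta+\pi}\rangle$ (outcomes $0,1$), $Z(\theta)=\mathrm{diag}(1,e^{i\theta})$, $N[i]=N(i)\cup\{i\}$,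 $A(i)=N[i]\setminus(I\cup\bigcup_{j<i}N[j])$, and, for signals $s$ and key $t$, $z(i)=\bigoplus_{k\prec i,\ i\in N(f(k))}s_k$, $t(i)=\bigoplus_{k\in I,\ i\in N(k)}t_k$, with $s_{f^{-1}(i)}=0$ if $i\notin f(V\setminus O)$ and $t_i=0$ if $i\notin I$. **The BOQCo protocol (honest Bob).** A key channel gives Alice and Oscar uniformly random bits $r_i$ ($i\in V\setminus O$) and $t_i$ ($i\in I$). Alice chooses $\alpha_i\in\Omega$ ($i\in V_{\mathcal A}\setminus O$) and Oscar $\beta_i\in\Omega$ ($i\in V_{\mathcal O}$) uniformly at random. 1. For each $k\in I$, Alice applies $Z(\alpha_k)X^{t_k}$ to input qubit $k$ (only $X^{t_k}$ if $k\in O$) and sends it to Bob; $\phi_k$ is replaced by $(-1)^{t_k}\phi_k$ by Alice, and $\phi_j$, respectively $\psi_j$, by $\phi_j+t_k\pi$, respectively $\psi_j+t_k\pi$, for the neighbours $j$ of $k$ in $V_{\mathcal A}$ by Alice, respectively in $V_{\mathcal O}$ by Oscar. 2. For each $i\in V$ in increasing order: * for each $k\in A(i)$: if $k\in O$, Bob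 prepares $|+\rangle_k$; otherwise the owner of $k$ prepares $|+_{\alpha_k}\rangle_k$ (Alice) or $|+_{\beta_k}\rangle_k$ (Oscar) and sends it to Bob; * Bob applies CPHASE between $i$ and each of its neighbours $k>i$; * if $i\notin O$, the owner of $i$ sends Bob the angle $\delta_i=(-1)^{s_{f^{-1}(i)}}\phi_i+z(i)\pi+\pi r_i+\alpha_i$ (Oscar: with $\psi_i,\beta_i$); Bob measures $i$ in the basis $|\pm_{\delta_i}\rangle$ and announces the outcome $\tilde s_i$ to Alice and Oscar, who both set $s_i=\tilde s_i\oplus r_i$; * if $i\in O$, Bob sends qubit $i$ to Alice, who applies $X^{s_{f^{-1}(i)}+t_i}Z^{z(i)+t(i)}$ to it. **Theorem.** With the entangling operator $E_{\mathcal G}=\prod_{(i,j)\in E}\mathrm{CPHASE}_{ij}$ and $N^0_{I^c}$ adjoining $|+\rangle$ at all nodes of $V\setminus I$, let $$U=\sqrt2^{\,|V\setminus O|}\ \bigotimes_{i\in V\setminus O}\langle +_{\theta_i}|_i\; E_{\mathcal G}\,N^0_{I^c}$$ be the operator, normalised, that the flow pattern of $(\mathcal G,I,O)$ with angles $\theta$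 realises. Then: * $U$ is an isometry. * The protocol implements it: on every input $\rho$, Alice's output state (over all measurement outcomes and all random choices) is $U\rho U^\dagger$. Moreover, for every value of $r,t,\alpha,\beta$ and every outcome string $\tilde s$, all commands of the run are executable (each party acts only on qubits that it holds and prepares a qubit only where none is present), Alice ends up with exactly the qubits $O$ and no other qubit is left, and the unnormalised output state of this branch is $2^{-|V\setminus O|}\,U\rho U^\dagger$. * Alice and Oscar do not share their computations: during the protocol neither sends anything to the other, and, for given keys $r,t$ and given announced outcomes $\tilde s$, the sequence of Alice's operations and messages does not depend on $(\psi,\beta)$, and that of Oscar's does not depend on $(\phi,\alpha)$. -/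

import Mathlib

open scoped Matrix

noncomputable section

namespace BOQCo

/-! ### Open graphs, flow, and the public data -/

/-- An open graph `(G, I, O)`: a simple graph with nonempty sets of input and output nodes,
which may intersect. -/
structure OpenGraph (V : Type*) where
  graph : SimpleGraph V
  I : Finset V
  O : Finset V
  I_nonempty : I.Nonempty
  O_nonempty : O.Nonempty

/-- A flow `(f, ≺)` on an open graph; `prec i j` means `i ≺ j`. -/
structure Flow {V : Type*} (G : OpenGraph V) where
  f : {v // v ∉ G.O} → {v // v ∉ G.I}
  prec : V → V → Prop
  strictOrder : IsStrictOrder V prec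
  F0 : ∀ j : {v // v ∉ G.O}, G.graph.Adj j (f j)
  F1 : ∀ j : {v // v ∉ G.O}, prec j (f j)
  F2 : ∀ (j : {v // v ∉ G.O}) (k : V), G.graph.Adj (f j) k → k ≠ j → prec j k

/-- The data fixed in the pre-protocol steps.  The total order `>` is the linear order on `V`.
Alice's graph is the graph induced on `VA`, Oscar's graph (whose pieces answer the oracle queries)
is the one induced on `VO`, and the edges between `VA` and `VO` are the connection joining them.
Oscar has no quantum input and no quantum output. -/
structure PublicInfo (V : Type*) [Fintype V] [LinearOrder V] where
  G : OpenGraph V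
  flow : Flow G
  order_consistent : ∀ i j, flow.prec i j → i < j
  VA : Finset V
  VO : Finset V
  cover : VA ∪ VO = Finset.univ
  disjoint : Disjoint VA VO
  input_alice : Disjoint G.I VO
  output_alice : Disjoint G.O VO
  b : ℕ

/-- The allowed angles `Ω = {π k / 2 ^ (b - 1) : 0 ≤ k < 2 ^ b}`. -/
def Ω (b : ℕ) : Finset ℝ :=
  (Finset.range (2 ^ b)).image fun k : ℕ => Real.pi * (k : ℝ) / (2 : ℝ) ^ ((b : ℤ) - 1)

/-! ### Single-qubit and two-qubit operations on a register of sites `V`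

The register carries one site for each node of the graph.  A site at which no qubit is present
(not prepared yet, or already measured) is kept in the state `|0⟩`. -/

/-- `(-1) ^ a` for a bit `a`. -/
def bitSign (a : ZMod 2) : ℝ := (-1) ^ a.val

/-- `|0⟩`. -/
def zeroKet : ZMod 2 → ℂ := fun a => if a = 0 then 1 else 0

/-- `|+_θ⟩ = (|0⟩ + e^{iθ} |1⟩) / √2`. -/
def plusKet (θ : ℝ) : ZMod 2 → ℂ := fun a =>
  if a = 0 then ((1 / Real.sqrt 2 : ℝ) : ℂ)
  else ((1 / Real.sqrt 2 : ℝ) : ℂ) * Complex.exp (Complex.I * θ)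

/-- `Z(θ) = diag (1, e^{iθ})`. -/
def rotZ (θ : ℝ) : Matrix (ZMod 2) (ZMod 2) ℂ :=
  Matrix.diagonal fun a => if a = 0 then 1 else Complex.exp (Complex.I * θ)

/-- Pauli `X`. -/
def pauliX : Matrix (ZMod 2) (ZMod 2) ℂ := fun a c => if a = c + 1 then 1 else 0

/-- Pauli `Z`. -/
def pauliZ : Matrix (ZMod 2) (ZMod 2) ℂ := Matrix.diagonal fun a => if a = 0 then 1 else -1

section Register

variable {V : Type*} [Fintype V] [DecidableEq V]

/-- The operator `M` on site `k`, tensored with the identity on all other sites. -/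
def onSite (k : V) (M : Matrix (ZMod 2) (ZMod 2) ℂ) : Matrix (V → ZMod 2) (V → ZMod 2) ℂ :=
  fun x y => if ∀ j, j ≠ k → x j = y j then M (x k) (y k) else 0

/-- The phase that CPHASE gives to the basis state `|a c⟩`. -/
def czPhase (a c : ZMod 2) : ℂ := if a = 1 ∧ c = 1 then -1 else 1

/-- CPHASE between the sites `k` and `l`. -/
def czGate (k l : V) : Matrix (V → ZMod 2) (V → ZMod 2) ℂ :=
  Matrix.diagonal fun x => czPhase (x k) (x l)

/-- The isometry placing the qubits labelled by `S` at their sites, all other sites being empty. -/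
def embed (S : Finset V) : Matrix (V → ZMod 2) (S → ZMod 2) ℂ := fun x y =>
  if (∀ i : S, x i = y i) ∧ ∀ i, i ∉ S → x i = 0 then 1 else 0

end Register

/-! ### Commands, and who executes them -/

inductive Party where
  | alice
  | bob
  | oscar
  deriving DecidableEq

/-- The commands that occur in a run; the first argument is the party that executes them.
`measure p k δ s` is the (destructive) measurement of qubit `k` in the basis `|±_δ⟩`
with outcome `s`. -/
inductive Command (V : Type*) where
  | prepare (p : Party) (k : V) (θ : ℝ)
  | rotZ (p : Party) (k : V) (θ : ℝ)
  | pauliX (p : Party) (k : V) (s : ZMod 2)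
  | pauliZ (p : Party) (k : V) (s : ZMod 2)
  | cz (p : Party) (k l : V)
  | measure (p : Party) (k : V) (δ : ℝ) (s : ZMod 2)
  | sendQubit (p q : Party) (k : V)
  | sendAngle (p q : Party) (k : V) (δ : ℝ)
  | sendOutcome (p q : Party) (k : V) (s : ZMod 2)

/-- The party that executes a command. -/
def Command.actor {V : Type*} : Command V → Party
  | .prepare p _ _ => p
  | .rotZ p _ _ => p
  | .pauliX p _ _ => p
  | .pauliZ p _ _ => p
  | .cz p _ _ => p
  | .measure p _ _ _ => p
  | .sendQubit p _ _ => p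
  | .sendAngle p _ _ _ => p
  | .sendOutcome p _ _ _ => p

/-- The receiving party, if the command is a (quantum or classical) transmission. -/
def Command.receiver {V : Type*} : Command V → Option Party
  | .sendQubit _ q _ => some q
  | .sendAngle _ q _ _ => some q
  | .sendOutcome _ q _ _ => some q
  | _ => none

/-- The operator of a command on the register (for a measurement: the Kraus operator of the
recorded outcome). -/
def Command.op {V : Type*} [Fintype V] [DecidableEq V] :
    Command V → Matrix (V → ZMod 2) (V → ZMod 2) ℂ
  | .prepare _ k θ => onSite k (Matrix.vecMulVec (plusKet θ) (star zeroKet))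
  | .rotZ _ k θ => onSite k (BOQCo.rotZ θ)
  | .pauliX _ k s => onSite k (BOQCo.pauliX ^ s.val)
  | .pauliZ _ k s => onSite k (BOQCo.pauliZ ^ s.val)
  | .cz _ k l => czGate k l
  | .measure _ k δ s =>
      onSite k (Matrix.vecMulVec zeroKet (star (plusKet (δ + (s.val : ℝ) * Real.pi))))
  | .sendQubit _ _ _ => 1
  | .sendAngle _ _ _ _ => 1
  | .sendOutcome _ _ _ _ => 1

/-- The operator of a list of commands, the head being executed first. -/
def commandsOp {V : Type*} [Fintype V] [DecidableEq V] :
    List (Command V) → Matrix (V → ZMod 2) (V → ZMod 2) ℂ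
  | [] => 1
  | c :: cs => commandsOp cs * c.op

/-- The effect of a command on the table that records which party holds which qubit (`none`: no
qubit is present at that site).  The result is `none` if the command is not executable: a party
acts only on qubits that it holds, and prepares a qubit only at an empty site. -/
def Command.exec {V : Type*} [DecidableEq V] (h : V → Option Party) :
    Command V → Option (V → Option Party)
  | .prepare p k _ => if h k = none then some (Function.update h k (some p)) else none
  | .rotZ p k _ => if h k = some p then some h else none
  | .pauliX p k _ => if h k = some p then some h else none
  | .pauliZ p k _ => if h k = some p then some h else none
  | .cz p k l => if h k = some p ∧ h l = some p ∧ k ≠ l then some h else none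
  | .measure p k _ _ => if h k = some p then some (Function.update h k none) else none
  | .sendQubit p q k => if h k = some p then some (Function.update h k (some q)) else none
  | .sendAngle _ _ _ _ => some h
  | .sendOutcome _ _ _ _ => some h

/-- Run a list of commands on the table of holders. -/
def execAll {V : Type*} [DecidableEq V] :
    (V → Option Party) → List (Command V) → Option (V → Option Party)
  | h, [] => some h
  | h, c :: cs => (c.exec h).bind fun h' => execAll h' cs

/-- The table in which Alice holds the qubits of `S` and no other qubit is present. -/
def heldByAlice {V : Type*} [DecidableEq V] (S : Finset V) : V → Option Party :=
  fun v => if v ∈ S then some Party.alice else none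

/-! ### The protocol -/

/-- The classical memory of a client: the current angles of its nodes, and the signals `s_i`
(zero as long as `i` is not measured). -/
structure Memory (V : Type*) where
  angle : V → ℝ
  s : V → ZMod 2

/-- The state of a run: the memories of the two clients and the commands executed so far. -/
structure Run (V : Type*) where
  alice : Memory V
  oscar : Memory V
  log : List (Command V)

namespace PublicInfo

variable {V : Type*} [Fintype V] [LinearOrder V] (P : PublicInfo V)

/-- Angles on Alice's measured nodes: the type of `φ` and of `α`. -/
abbrev AliceAngles := {i // i ∈ P.VA ∧ i ∉ P.G.O} → Ω P.b

/-- Angles on Oscar's nodes (all of which are measured): the type of `ψ` and of `β`. -/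
abbrev OscarAngles := {i // i ∈ P.VO} → Ω P.b

/-- The keys `(r, t)` delivered to Alice and Oscar by the secure key channel. -/
abbrev Keys := ({i // i ∉ P.G.O} → ZMod 2) × ({i // i ∈ P.G.I} → ZMod 2)

/-- One measurement outcome `s̃_i`, reported by Bob, for each measured node. -/
abbrev Outcomes := {i // i ∉ P.G.O} → ZMod 2

variable {P}

/-- Angles on Alice's measured nodes, extended by zero. -/
def aliceExt (φ : P.AliceAngles) (i : V) : ℝ :=
  if h : i ∈ P.VA ∧ i ∉ P.G.O then (φ ⟨i, h⟩ : ℝ) else 0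

/-- Angles on Oscar's nodes, extended by zero. -/
def oscarExt (ψ : P.OscarAngles) (i : V) : ℝ :=
  if h : i ∈ P.VO then (ψ ⟨i, h⟩ : ℝ) else 0

/-- `r_i`. -/
def keyR (κ : P.Keys) (i : V) : ZMod 2 := if h : i ∉ P.G.O then κ.1 ⟨i, h⟩ else 0

/-- `t_i`, with `t_i = 0` for `i ∉ I`. -/
def keyT (κ : P.Keys) (i : V) : ZMod 2 := if h : i ∈ P.G.I then κ.2 ⟨i, h⟩ else 0

open Classical in
/-- `t(i)`, the sum modulo 2 of `t_k` over the inputs `k` adjacent to `i`. -/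
def tSignal (κ : P.Keys) (i : V) : ZMod 2 :=
  ∑ k : {k // k ∈ P.G.I}, if P.G.graph.Adj k i then κ.2 k else 0

variable (P)

/-- `s_{f⁻¹(i)}`, which is zero if `i` is not in the range of `f` (in particular if `i ∈ I`).
As `f` is injective, the sum has at most one term. -/
def invSignal (s : V → ZMod 2) (i : V) : ZMod 2 :=
  ∑ j : {j // j ∉ P.G.O}, if (P.flow.f j : V) = i then s j else 0

open Classical in
/-- `z(i)`, the sum modulo 2 of `s_k` over all `k ≺ i` with `i ∈ N(f(k))`. -/
def zSignal (s : V → ZMod 2) (i : V) : ZMod 2 :=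
  ∑ k : {k // k ∉ P.G.O},
    if P.flow.prec k i ∧ P.G.graph.Adj (P.flow.f k) i then s k else 0

open Classical in
/-- The closed neighbourhood `N[i]`. -/
def closedNbhd (i : V) : Finset V := Finset.univ.filter fun k => k = i ∨ P.G.graph.Adj i k

/-- `A(i) = N[i] \ (I ∪ ⋃_{j < i} N[j])`, the qubits to be prepared in round `i`. -/
def fresh (i : V) : Finset V :=
  P.closedNbhd i \ (P.G.I ∪ (Finset.univ.filter (· < i)).biUnion P.closedNbhd)

open Classical in
/-- The neighbours of `i` that come after `i`. -/
def laterNbhd (i : V) : Finset V := Finset.univ.filter fun k => P.G.graph.Adj i k ∧ i < k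

variable {P}

open Classical in
/-- A client with nodes `own` updates its angles when the input qubit `k` is sent, encrypted with
`X ^ t_k`: `φ_k` becomes `(-1) ^ t_k φ_k`, and `φ_j` becomes `φ_j + t_k π` for `j` adjacent
to `k`. -/
def updateAngles (own : Finset V) (κ : P.Keys) (k : V) (m : Memory V) : Memory V where
  angle j :=
    if j ∉ own then m.angle j
    else if j = k then bitSign (keyT κ k) * m.angle j
    else if P.G.graph.Adj k j then m.angle j + ((keyT κ k).val : ℝ) * Real.pi
    else m.angle j
  s := m.s

/-- The angle `δ_i = (-1) ^ s_{f⁻¹(i)} φ_i + z(i) π + π r_i + γ_i` computed by a client from the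
keys, its own memory and its own random angles `γ`. -/
def delta (κ : P.Keys) (γ : V → ℝ) (m : Memory V) (i : V) : ℝ :=
  bitSign (P.invSignal m.s i) * m.angle i + ((P.zSignal m.s i).val : ℝ) * Real.pi
    + Real.pi * ((keyR κ i).val : ℝ) + γ i

/-- A client receives the outcome `s̃_i` and stores `s_i = s̃_i ⊕ r_i`. -/
def record (κ : P.Keys) (i : V) (outcome : ZMod 2) (m : Memory V) : Memory V where
  angle := m.angle
  s := Function.update m.s i (outcome + keyR κ i)

/-- Alice encrypts the input qubit `k` with `Z(α_k) X ^ t_k` and sends it to Bob; both clients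
update their angles.  (If `k` is also an output, it is never measured and `α_k` is absent.) -/
def inputRound (κ : P.Keys) (α : P.AliceAngles) (R : Run V) (k : V) : Run V where
  alice := updateAngles P.VA κ k R.alice
  oscar := updateAngles P.VO κ k R.oscar
  log := R.log ++
    [.pauliX .alice k (keyT κ k), .rotZ .alice k (aliceExt α k), .sendQubit .alice .bob k]

/-- The preparation of a non-input qubit `k`: by Bob if `k` is an output, otherwise by its owner,
who sends it to Bob. -/
def prepareCommands (α : P.AliceAngles) (β : P.OscarAngles) (k : V) : List (Command V) :=
  if k ∈ P.G.O then [.prepare .bob k 0]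
  else if k ∈ P.VA then [.prepare .alice k (aliceExt α k), .sendQubit .alice .bob k]
  else [.prepare .oscar k (oscarExt β k), .sendQubit .oscar .bob k]

/-- The measurement of node `i`, at the request `δ` of `client`, with outcome `s̃`. -/
def measureCommands (client : Party) (i : V) (δ : ℝ) (outcome : ZMod 2) : List (Command V) :=
  [.sendAngle client .bob i δ, .measure .bob i δ outcome,
    .sendOutcome .bob .alice i outcome, .sendOutcome .bob .oscar i outcome]

/-- The transmission of the output qubit `i` and its correction
`X ^ (s_{f⁻¹(i)} + t_i) Z ^ (z(i) + t(i))` by Alice, from the keys and her own memory `m`. -/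
def outputCommands (κ : P.Keys) (m : Memory V) (i : V) : List (Command V) :=
  [.sendQubit .bob .alice i,
    .pauliZ .alice i (P.zSignal m.s i + tSignal κ i),
    .pauliX .alice i (P.invSignal m.s i + keyT κ i)]

/-- The round of node `i`: preparation of the fresh qubits `A(i)`, entangling of `i` with its later
neighbours, then measurement (if `i ∉ O`) or output (if `i ∈ O`). -/
def nodeRound (κ : P.Keys) (α : P.AliceAngles) (β : P.OscarAngles) (ω : P.Outcomes)
    (R : Run V) (i : V) : Run V :=
  let start : List (Command V) :=
    R.log ++ ((P.fresh i).sort).flatMap (prepareCommands α β)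
      ++ ((P.laterNbhd i).sort).map (Command.cz .bob i)
  if h : i ∉ P.G.O then
    { alice := record κ i (ω ⟨i, h⟩) R.alice
      oscar := record κ i (ω ⟨i, h⟩) R.oscar
      log := start ++
        if i ∈ P.VA then
          measureCommands .alice i (delta κ (aliceExt α) R.alice i) (ω ⟨i, h⟩)
        else
          measureCommands .oscar i (delta κ (oscarExt β) R.oscar i) (ω ⟨i, h⟩) }
  else
    { alice := R.alice
      oscar := R.oscar
      log := start ++ outputCommands κ R.alice i }

/-- The run of the protocol with honest Bob, for given inputs `φ`, `ψ`, keys `κ`, random angles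
`α`, `β`, and measurement outcomes `ω`: the inputs are sent, then all nodes are processed
in increasing order. -/
def run (φ : P.AliceAngles) (ψ : P.OscarAngles) (κ : P.Keys) (α : P.AliceAngles)
    (β : P.OscarAngles) (ω : P.Outcomes) : Run V :=
  (((Finset.univ : Finset V).sort).foldl (nodeRound κ α β ω)
    ((P.G.I.sort).foldl (inputRound κ α)
      { alice := { angle := aliceExt φ, s := 0 }
        oscar := { angle := oscarExt ψ, s := 0 }
        log := [] }))

/-- The unnormalised state that Alice obtains on the output qubits when the outcomes are `ω`;
its trace is the probability of `ω`. -/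
def branchOutput (φ : P.AliceAngles) (ψ : P.OscarAngles) (κ : P.Keys) (α : P.AliceAngles)
    (β : P.OscarAngles) (ω : P.Outcomes)
    (ρ : Matrix (P.G.I → ZMod 2) (P.G.I → ZMod 2) ℂ) :
    Matrix (P.G.O → ZMod 2) (P.G.O → ZMod 2) ℂ :=
  let K := (embed P.G.O)ᴴ * commandsOp (run φ ψ κ α β ω).log * embed P.G.I
  K * ρ * Kᴴ

/-- Alice's output state on input `ρ`: the sum over all measurement outcomes, averaged over the
uniformly random keys and angles. -/
def protocolOutput (φ : P.AliceAngles) (ψ : P.OscarAngles)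
    (ρ : Matrix (P.G.I → ZMod 2) (P.G.I → ZMod 2) ℂ) :
    Matrix (P.G.O → ZMod 2) (P.G.O → ZMod 2) ℂ :=
  (Fintype.card (P.Keys × P.AliceAngles × P.OscarAngles) : ℂ)⁻¹ •
    ∑ x : P.Keys × P.AliceAngles × P.OscarAngles, ∑ ω : P.Outcomes,
      branchOutput φ ψ x.1 x.2.1 x.2.2 ω ρ

/-! ### The isometry of the flow pattern -/

variable (P)

/-- `N⁰_{Iᶜ}`: adjoin `|+⟩` at every non-input node. -/
def prepareAll : Matrix (V → ZMod 2) (P.G.I → ZMod 2) ℂ := fun x y =>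
  if ∀ i : P.G.I, x i = y i then ∏ k ∈ P.G.Iᶜ, plusKet 0 (x k) else 0

open Classical in
/-- `E_G`: CPHASE along every edge of the graph. -/
def entangleAll : Matrix (V → ZMod 2) (V → ZMod 2) ℂ :=
  Matrix.diagonal fun x =>
    ∏ p ∈ (Finset.univ : Finset (V × V)).filter (fun p => p.1 < p.2 ∧ P.G.graph.Adj p.1 p.2),
      czPhase (x p.1) (x p.2)

/-- `⨂_{i ∈ Oᶜ} ⟨+_{θ_i}|`. -/
def braAll (θ : V → ℝ) : Matrix (P.G.O → ZMod 2) (V → ZMod 2) ℂ := fun y x =>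
  if ∀ i : P.G.O, x i = y i then ∏ k ∈ P.G.Oᶜ, star (plusKet (θ k) (x k)) else 0

variable {P}

/-- The isometry `⨂_{i ∈ Oᶜ} ⟨+_{θ_i}| E_G N⁰_{Iᶜ}` realised by the flow pattern with angles
`θ = φ ∪ ψ`, with its normalisation `√2 ^ |Oᶜ|`. -/
def isometry (φ : P.AliceAngles) (ψ : P.OscarAngles) :
    Matrix (P.G.O → ZMod 2) (P.G.I → ZMod 2) ℂ :=
  ((Real.sqrt 2 : ℝ) : ℂ) ^ (P.G.Oᶜ).card •
    (P.braAll (fun i => if i ∈ P.VA then aliceExt φ i else oscarExt ψ i)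
      * P.entangleAll * P.prepareAll)

end PublicInfo

end BOQCo

end

noncomputable section

namespace BOQCo

/-! ### Lists of commands -/

/-! A round uses only signals of earlier nodes, since `≺` is contained in `<`. The memories can
therefore be replaced by the final signals, and the run becomes an explicit list of commands
(`run_log`). Silence and independence are read off this list, because signals depend only on keys
and outcomes. Executability follows from an invariant on the table of holders (`execAll_round`).

For correctness, commuting operators on disjoint sites turns the interleaved run into "finish
everything, after entangling everything, after preparing everything" (`commandsOp_run_log`). A
branch is then a sum over bit strings `w` of site factors times the sign `(-1)^q(w)`, where `q` is
the quadratic form of the graph. Translating `w` by the X byproducts leaves a sign linear in `w`,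
given by the polar form of `q`. The flow conditions say that its coefficients are the Z byproducts
(`sum_byproductX`, `edgePhase_add`). Site by site, the adapted angles and Alice's corrections
produce the same sign, and the random angles cancel (`startOp_apply`, `finishOp_apply`). Hence every
branch is a scalar of modulus one times the same pattern operator (`branchOp_eq`).

The isometry property needs no gate-by-gate analysis. Adaptive measurements are complete
(`adaptive_isometry`), so the products `Kᴴ K` over all branches add up to the identity
(`sum_branchOp`). They are all equal and there are `2 ^ |Oᶜ|` of them, which also fixes the
normalisation (`patternOp_isometry`). -/

lemma commandsOp_append {V : Type*} [Fintype V] [DecidableEq V] (l₁ l₂ : List (Command V)) :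
    commandsOp (l₁ ++ l₂) = commandsOp l₂ * commandsOp l₁ := by
  induction l₁ with
  | nil => simp [commandsOp]
  | cons c cs ih => simp [commandsOp, ih, Matrix.mul_assoc]

lemma execAll_append {V : Type*} [DecidableEq V] (h : V → Option Party)
    (l₁ l₂ : List (Command V)) :
    execAll h (l₁ ++ l₂) = (execAll h l₁).bind fun h' => execAll h' l₂ := by
  induction l₁ generalizing h with
  | nil => simp [execAll]
  | cons c cs ih => simp [execAll, ih, Option.bind_assoc]

/-- Induction along the increasing enumeration of a finite linear order. -/
theorem sort_univ_induction {V : Type*} [Fintype V] [LinearOrder V]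
    {motive : Finset V → List V → Prop} (nil : motive ∅ [])
    (snoc : ∀ l i, motive (Finset.univ.filter (· < i)) l →
      motive (insert i (Finset.univ.filter (· < i))) (l ++ [i])) :
    motive Finset.univ (Finset.univ : Finset V).sort := by
  have key : ∀ l : List V, l <+: (Finset.univ : Finset V).sort → motive l.toFinset l := by
    intro l
    induction l using List.reverseRecOn with
    | nil => intro _; simpa using nil
    | append_singleton l i ih =>
      intro hl
      have hS : l.toFinset = Finset.univ.filter (· < i) := by
        obtain ⟨r, hr⟩ := hl
        have hp : (Finset.univ : Finset V).sort.Pairwise (· < ·) :=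
          (Finset.sortedLT_sort _).pairwise
        rw [← hr] at hp
        simp only [List.pairwise_append, List.mem_append, List.mem_singleton] at hp
        ext j
        have hj : j ∈ l ++ [i] ++ r := by rw [hr]; simp
        simp only [List.mem_append, List.mem_singleton] at hj
        simp only [List.mem_toFinset, Finset.mem_filter, Finset.mem_univ, true_and]
        refine ⟨fun h => hp.1.2.2 j h i rfl, fun h => ?_⟩
        rcases hj with (hj | hj) | hj
        · exact hj
        · exact absurd h (by simp [hj])
        · exact absurd (hp.2.2 i (Or.inr rfl) j hj) (not_lt.2 h.le)
      have := snoc l i (hS ▸ ih ((List.prefix_append l [i]).trans hl))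
      rw [← hS] at this
      have hins : (l ++ [i]).toFinset = insert i l.toFinset := by ext; simp
      rwa [hins]
  simpa using key _ (List.prefix_refl _)

namespace PublicInfo

variable {V : Type*} [Fintype V] [LinearOrder V] {P : PublicInfo V}

/-! ### The log of a run as an explicit list -/

/-- The signals `s_i` at the end of the run. -/
def signals (κ : P.Keys) (ω : P.Outcomes) (i : V) : ZMod 2 :=
  if h : i ∉ P.G.O then ω ⟨i, h⟩ + keyR κ i else 0

/-- A client's angles after all inputs have been sent. -/
def encryptedAngle (own : Finset V) (κ : P.Keys) (γ : V → ℝ) : V → ℝ :=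
  (P.G.I.sort.foldl (fun m k => updateAngles own κ k m) ({ angle := γ, s := 0 } : Memory V)).angle

/-- The commands by which the input qubit `k` is encrypted and sent. -/
def inputCommands (κ : P.Keys) (α : P.AliceAngles) (k : V) : List (Command V) :=
  [.pauliX .alice k (keyT κ k), .rotZ .alice k (aliceExt α k), .sendQubit .alice .bob k]

/-- The commands of the round of node `i` after the entangling. -/
def finishCommands (φ : P.AliceAngles) (ψ : P.OscarAngles) (κ : P.Keys) (α : P.AliceAngles)
    (β : P.OscarAngles) (ω : P.Outcomes) (i : V) : List (Command V) :=
  if h : i ∉ P.G.O then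
    if i ∈ P.VA then
      measureCommands .alice i
        (delta κ (aliceExt α) ⟨encryptedAngle P.VA κ (aliceExt φ), signals κ ω⟩ i) (ω ⟨i, h⟩)
    else
      measureCommands .oscar i
        (delta κ (oscarExt β) ⟨encryptedAngle P.VO κ (oscarExt ψ), signals κ ω⟩ i) (ω ⟨i, h⟩)
  else outputCommands κ ⟨encryptedAngle P.VA κ (aliceExt φ), signals κ ω⟩ i

/-- The commands of the round of node `i`. -/
def roundCommands (φ : P.AliceAngles) (ψ : P.OscarAngles) (κ : P.Keys) (α : P.AliceAngles)
    (β : P.OscarAngles) (ω : P.Outcomes) (i : V) : List (Command V) :=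
  (P.fresh i).sort.flatMap (prepareCommands α β) ++ (P.laterNbhd i).sort.map (Command.cz .bob i)
    ++ finishCommands φ ψ κ α β ω i

/-- Causality: a node `j` with `f j = i` satisfies `j ≺ i`, hence `j < i`. This is what allows a
memory filled only below `i` to be exchanged for the final signals. -/
lemma invSignal_congr {s s' : V → ZMod 2} {i : V} (h : ∀ j < i, s j = s' j) :
    P.invSignal s i = P.invSignal s' i := by
  refine Finset.sum_congr rfl fun j _ => ?_
  split_ifs with hj
  · exact h _ (P.order_consistent _ _ (hj ▸ P.flow.F1 j))
  · rfl

lemma zSignal_congr {s s' : V → ZMod 2} {i : V} (h : ∀ j < i, s j = s' j) :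
    P.zSignal s i = P.zSignal s' i := by
  refine Finset.sum_congr rfl fun j _ => ?_
  split_ifs with hj
  · exact h _ (P.order_consistent _ _ hj.1)
  · rfl

lemma delta_congr (κ : P.Keys) (γ : V → ℝ) {m m' : Memory V} {i : V}
    (ha : m.angle i = m'.angle i) (h : ∀ j < i, m.s j = m'.s j) :
    delta κ γ m i = delta κ γ m' i := by
  simp only [delta, ha, invSignal_congr h, zSignal_congr h]

lemma foldl_inputRound (κ : P.Keys) (α : P.AliceAngles) (l : List V) (R : Run V) :
    l.foldl (inputRound κ α) R =
      { alice := l.foldl (fun m k => updateAngles P.VA κ k m) R.alice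
        oscar := l.foldl (fun m k => updateAngles P.VO κ k m) R.oscar
        log := R.log ++ l.flatMap (inputCommands κ α) } := by
  induction l generalizing R with
  | nil => simp
  | cons k l ih => simp [ih, inputRound, inputCommands]

lemma foldl_updateAngles_s (own : Finset V) (κ : P.Keys) (l : List V) (m : Memory V) :
    (l.foldl (fun m k => updateAngles own κ k m) m).s = m.s := by
  induction l generalizing m with
  | nil => rfl
  | cons k l ih => rw [List.foldl_cons, ih]; rfl

lemma update_signals (κ : P.Keys) (ω : P.Outcomes) (S : Finset V) (i : V) (h : i ∉ P.G.O) :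
    Function.update (fun k => if k ∈ S then signals κ ω k else 0) i (ω ⟨i, h⟩ + keyR κ i) =
      fun k => if k ∈ insert i S then signals κ ω k else 0 := by
  ext k
  by_cases hk : k = i
  · subst hk; simp [signals, h]
  · simp [hk]

/-- Invariant: once the nodes of `S` are processed, both clients store the final signals truncated
to `S`. By causality the truncation is invisible to the next round. -/
theorem run_log (φ : P.AliceAngles) (ψ : P.OscarAngles) (κ : P.Keys) (α : P.AliceAngles)
    (β : P.OscarAngles) (ω : P.Outcomes) :
    (run φ ψ κ α β ω).log = P.G.I.sort.flatMap (inputCommands κ α) ++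
      (Finset.univ : Finset V).sort.flatMap (roundCommands φ ψ κ α β ω) := by
  have key := sort_univ_induction (V := V) (motive := fun S l =>
    l.foldl (nodeRound κ α β ω)
      { alice := ⟨encryptedAngle P.VA κ (aliceExt φ), 0⟩
        oscar := ⟨encryptedAngle P.VO κ (oscarExt ψ), 0⟩
        log := P.G.I.sort.flatMap (inputCommands κ α) } =
      { alice := ⟨encryptedAngle P.VA κ (aliceExt φ), fun k => if k ∈ S then signals κ ω k else 0⟩
        oscar := ⟨encryptedAngle P.VO κ (oscarExt ψ), fun k => if k ∈ S then signals κ ω k else 0⟩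
        log := P.G.I.sort.flatMap (inputCommands κ α) ++
          l.flatMap (roundCommands φ ψ κ α β ω) })
    (by simp; rfl) (by
      intro l i ih
      have hs : ∀ j < i, (if j ∈ Finset.univ.filter (· < i) then signals κ ω j else 0) =
          signals κ ω j := fun j hj => by simp [hj]
      rw [List.foldl_append, ih]
      simp only [List.foldl_cons, List.foldl_nil, nodeRound, record]
      by_cases h : i ∈ P.G.O
      -- An output node records nothing, which is consistent because `signals` vanishes there.
      · have hins : (fun k => if k ∈ insert i (Finset.univ.filter (· < i)) then signals κ ω k
            else 0) = fun k => if k ∈ Finset.univ.filter (· < i) then signals κ ω k else 0 := by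
          ext k
          by_cases hk : k = i
          · subst hk; simp [signals, h]
          · simp [hk]
        simp only [h, not_true_eq_false, dite_false, hins, Run.mk.injEq, true_and]
        simp only [roundCommands, finishCommands, h, outputCommands, invSignal_congr hs,
          zSignal_congr hs, not_true_eq_false, dite_false, List.flatMap_append,
          List.flatMap_cons, List.flatMap_nil, List.append_nil, List.append_assoc]
      · rw [dif_pos h]
        simp only [update_signals, Run.mk.injEq, true_and]
        simp only [roundCommands, finishCommands, h, not_false_eq_true, dite_true,
          List.flatMap_append, List.flatMap_cons, List.flatMap_nil, List.append_nil,
          List.append_assoc]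
        congr 4
        split_ifs <;> rw [delta_congr] <;> first | rfl | exact hs)
  have hA := foldl_updateAngles_s P.VA κ P.G.I.sort ⟨aliceExt φ, 0⟩
  have hB := foldl_updateAngles_s P.VO κ P.G.I.sort ⟨oscarExt ψ, 0⟩
  have h0 : run φ ψ κ α β ω = (Finset.univ : Finset V).sort.foldl (nodeRound κ α β ω)
      { alice := ⟨encryptedAngle P.VA κ (aliceExt φ), 0⟩
        oscar := ⟨encryptedAngle P.VO κ (oscarExt ψ), 0⟩
        log := P.G.I.sort.flatMap (inputCommands κ α) } := by
    rw [run, foldl_inputRound]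
    congr 2
    · exact congrArg (Memory.mk _) hA
    · exact congrArg (Memory.mk _) hB
  rw [h0, key]

/-! ### Communication and independence -/

theorem alice_oscar_silent (φ : P.AliceAngles) (ψ : P.OscarAngles) (κ : P.Keys)
    (α : P.AliceAngles) (β : P.OscarAngles) (ω : P.Outcomes) :
    ∀ c ∈ (run φ ψ κ α β ω).log,
      ¬ (c.actor = .alice ∧ c.receiver = some .oscar) ∧
      ¬ (c.actor = .oscar ∧ c.receiver = some .alice) := by
  intro c hc
  rw [run_log] at hc
  simp only [List.mem_append, List.mem_flatMap, roundCommands, List.mem_map] at hc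
  rcases hc with ⟨k, -, hc⟩ | ⟨i, -, (⟨k, -, hc⟩ | ⟨k, -, hc⟩) | hc⟩
  · simp only [inputCommands, List.mem_cons, List.not_mem_nil, or_false] at hc
    rcases hc with rfl | rfl | rfl <;> simp [Command.actor, Command.receiver]
  · unfold prepareCommands at hc
    split_ifs at hc <;>
      simp only [List.mem_cons, List.not_mem_nil, or_false] at hc
    · rcases hc with rfl; simp [Command.actor, Command.receiver]
    all_goals rcases hc with rfl | rfl <;> simp [Command.actor, Command.receiver]
  · rcases hc with rfl; simp [Command.actor, Command.receiver]
  · unfold finishCommands measureCommands outputCommands at hc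
    split_ifs at hc <;>
      simp only [List.mem_cons, List.not_mem_nil, or_false] at hc
    · rcases hc with rfl | rfl | rfl <;> simp [Command.actor, Command.receiver]
    · rcases hc with rfl | rfl | rfl | rfl <;> simp [Command.actor, Command.receiver]
    · rcases hc with rfl | rfl | rfl | rfl <;> simp [Command.actor, Command.receiver]

/-- In the explicit log, `ψ` and `β` occur only in commands at Oscar's nodes whose actor is Oscar.
Alice's angles and the common signals involve neither. -/
theorem alice_log_independent (φ : P.AliceAngles) (ψ ψ' : P.OscarAngles) (κ : P.Keys)
    (α : P.AliceAngles) (β β' : P.OscarAngles) (ω : P.Outcomes) :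
    (run φ ψ κ α β ω).log.filter (fun c => c.actor = .alice) =
      (run φ ψ' κ α β' ω).log.filter (fun c => c.actor = .alice) := by
  rw [run_log, run_log]
  simp only [List.filter_append, List.filter_flatMap, roundCommands]
  congr 2
  ext1 i
  congr 1
  · congr 2
    ext1 k
    unfold prepareCommands
    split_ifs <;> simp [Command.actor]
  · unfold finishCommands measureCommands
    split_ifs <;> simp [Command.actor]

theorem oscar_log_independent (φ φ' : P.AliceAngles) (ψ : P.OscarAngles) (κ : P.Keys)
    (α α' : P.AliceAngles) (β : P.OscarAngles) (ω : P.Outcomes) :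
    (run φ ψ κ α β ω).log.filter (fun c => c.actor = .oscar) =
      (run φ' ψ κ α' β ω).log.filter (fun c => c.actor = .oscar) := by
  rw [run_log, run_log]
  simp only [List.filter_append, List.filter_flatMap, roundCommands]
  -- The input blocks contain `α`, so the two sides agree there only because the filter empties
  -- them.
  have hin : ∀ α : P.AliceAngles, ∀ k,
      (inputCommands κ α k).filter (fun c => c.actor = .oscar) = [] := by
    simp [inputCommands, Command.actor]
  simp only [hin]
  congr 2
  ext1 i
  congr 1
  · congr 2
    ext1 k
    unfold prepareCommands
    split_ifs <;> simp [Command.actor]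
  · unfold finishCommands measureCommands outputCommands
    split_ifs <;> simp [Command.actor]

end PublicInfo

/-! ### Execution of blocks of commands on distinct sites -/

lemma execAll_flatMap {V : Type*} [DecidableEq V] {g : V → List (Command V)}
    {a b : Option Party} {l : List V} (hl : l.Nodup)
    (hg : ∀ k ∈ l, ∀ h : V → Option Party, h k = a →
      execAll h (g k) = some (Function.update h k b))
    (h : V → Option Party) (ha : ∀ k ∈ l, h k = a) :
    execAll h (l.flatMap g) = some fun v => if v ∈ l then b else h v := by
  induction l generalizing h with
  | nil => simp [execAll]
  | cons k l ih =>
    obtain ⟨hk, hl⟩ := List.nodup_cons.1 hl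
    rw [List.flatMap_cons, execAll_append, hg k (by simp) h (ha k (by simp)), Option.bind_some,
      ih hl fun j hj => hg j (by simp [hj])]
    · congr 1
      ext1 v
      by_cases hv : v = k
      · subst hv; simp [hk]
      · simp [hv]
    · intro j hj
      rw [Function.update_of_ne (ne_of_mem_of_not_mem hj hk)]
      exact ha j (by simp [hj])

lemma execAll_cz {V : Type*} [DecidableEq V] {p : Party} {i : V} {l : List V}
    {h : V → Option Party} (hi : h i = some p) (hl : ∀ k ∈ l, h k = some p ∧ i ≠ k) :
    execAll h (l.map (Command.cz p i)) = some h := by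
  induction l with
  | nil => simp [execAll]
  | cons k l ih =>
    have hk := hl k (by simp)
    simp only [List.map_cons, execAll, Command.exec, hi, hk.1, hk.2, ne_eq, not_false_eq_true,
      and_self, if_true, Option.bind_some]
    exact ih fun j hj => hl j (by simp [hj])

namespace PublicInfo

variable {V : Type*} [Fintype V] [LinearOrder V] {P : PublicInfo V}

lemma mem_closedNbhd {i k : V} : k ∈ P.closedNbhd i ↔ k = i ∨ P.G.graph.Adj i k := by
  simp [closedNbhd]

lemma mem_laterNbhd {i k : V} : k ∈ P.laterNbhd i ↔ P.G.graph.Adj i k ∧ i < k := by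
  simp [laterNbhd]

lemma mem_fresh {i k : V} :
    k ∈ P.fresh i ↔ k ∈ P.closedNbhd i ∧ k ∉ P.G.I ∧ ∀ j < i, k ∉ P.closedNbhd j := by
  simp [fresh]

lemma not_lt_of_mem_fresh {i k : V} (hk : k ∈ P.fresh i) : ¬ k < i := fun h =>
  (mem_fresh.1 hk).2.2 k h (mem_closedNbhd.2 (Or.inl rfl))

lemma mem_VA_of_mem_O {i : V} (hi : i ∈ P.G.O) : i ∈ P.VA := by
  have : i ∈ P.VA ∪ P.VO := P.cover ▸ Finset.mem_univ i
  exact (Finset.mem_union.1 this).resolve_right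
    (Finset.disjoint_left.1 P.output_alice hi)

/-! ### Executability -/

variable (P) in
open Classical in
/-- The table of holders after the rounds of the nodes in `S`. -/
def holders (S : Finset V) (v : V) : Option Party :=
  if v ∈ S then if v ∈ P.G.O then some .alice else none
  else if v ∈ P.G.I ∨ ∃ j ∈ S, v ∈ P.closedNbhd j then some .bob else none

lemma execAll_inputs (κ : P.Keys) (α : P.AliceAngles) :
    execAll (heldByAlice P.G.I) (P.G.I.sort.flatMap (inputCommands κ α)) =
      some (P.holders ∅) := by
  rw [execAll_flatMap (a := some .alice) (b := some .bob) (Finset.sort_nodup _ _)]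
  · congr 1
    ext1 v
    by_cases hv : v ∈ P.G.I <;> simp [holders, heldByAlice, hv]
  · intro k _ h hk
    simp [inputCommands, execAll, Command.exec, hk]
  · intro k hk
    simpa [heldByAlice] using hk

lemma execAll_prepare (α : P.AliceAngles) (β : P.OscarAngles) (k : V) (h : V → Option Party)
    (hk : h k = none) :
    execAll h (prepareCommands α β k) = some (Function.update h k (some .bob)) := by
  unfold prepareCommands
  split_ifs <;> simp [execAll, Command.exec, hk]

lemma execAll_finish (φ : P.AliceAngles) (ψ : P.OscarAngles) (κ : P.Keys) (α : P.AliceAngles)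
    (β : P.OscarAngles) (ω : P.Outcomes) (i : V) (h : V → Option Party) (hi : h i = some .bob) :
    execAll h (finishCommands φ ψ κ α β ω i) =
      some (Function.update h i (if i ∈ P.G.O then some .alice else none)) := by
  unfold finishCommands
  split_ifs <;> first
    | contradiction
    | simp [measureCommands, outputCommands, execAll, Command.exec, hi]

/-- The set `A(i)` consists of exactly those sites of `N[i]` that are neither inputs nor reached by
an earlier round. Its sites are thus empty, and after filling them Bob holds `i` and all its later
neighbours, as entangling requires. -/
lemma execAll_round (φ : P.AliceAngles) (ψ : P.OscarAngles) (κ : P.Keys) (α : P.AliceAngles)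
    (β : P.OscarAngles) (ω : P.Outcomes) (i : V) :
    execAll (P.holders (Finset.univ.filter (· < i))) (roundCommands φ ψ κ α β ω i) =
      some (P.holders (insert i (Finset.univ.filter (· < i)))) := by
  have hnone : ∀ k ∈ (P.fresh i).sort, P.holders (Finset.univ.filter (· < i)) k = none := by
    intro k hk
    rw [Finset.mem_sort] at hk
    have h1 := not_lt_of_mem_fresh hk
    have h2 := mem_fresh.1 hk
    simp only [holders, Finset.mem_filter, Finset.mem_univ, true_and, h1, if_false, h2.2.1,
      false_or]
    rw [if_neg]
    rintro ⟨j, hj, hj'⟩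
    exact h2.2.2 j hj hj'
  have hbob : ∀ k ∈ P.closedNbhd i, i ≤ k →
      (if k ∈ (P.fresh i).sort then some Party.bob
        else P.holders (Finset.univ.filter (· < i)) k) = some .bob := by
    intro k hk hik
    split_ifs with hf
    · rfl
    · rw [Finset.mem_sort] at hf
      simp only [holders, Finset.mem_filter, Finset.mem_univ, true_and, not_lt.2 hik, if_false]
      rw [if_pos]
      by_contra hcon
      push Not at hcon
      exact hf (mem_fresh.2 ⟨hk, hcon⟩)
  have hself : i ∈ P.closedNbhd i := mem_closedNbhd.2 (Or.inl rfl)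
  rw [roundCommands, execAll_append, execAll_append,
    execAll_flatMap (Finset.sort_nodup _ _) (fun k _ => execAll_prepare α β k) _ hnone,
    Option.bind_some,
    execAll_cz (p := .bob) (i := i), Option.bind_some, execAll_finish]
  · congr 1
    ext1 v
    by_cases hv : v = i
    · subst hv; simp [holders]
    rw [Function.update_of_ne hv]
    by_cases hf : v ∈ P.fresh i
    · have h1 := not_lt_of_mem_fresh hf
      simp [holders, hf, hv, h1, (mem_fresh.1 hf).1]
    -- Off `A(i)`, adding `i` to the processed nodes reaches no new site.
    · have h2 : v ∈ P.closedNbhd i → v ∈ P.G.I ∨ ∃ j < i, v ∈ P.closedNbhd j := by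
        intro h
        by_contra hcon
        push Not at hcon
        exact hf (mem_fresh.2 ⟨h, hcon⟩)
      simp only [Finset.mem_sort, hf, if_false, holders, Finset.mem_insert, hv, false_or,
        Finset.mem_filter, Finset.mem_univ, true_and,
        exists_eq_or_imp]
      congr 2
      exact propext ⟨by tauto, by tauto⟩
  · exact hbob i hself le_rfl
  · exact hbob i hself le_rfl
  · intro k hk
    rw [Finset.mem_sort, mem_laterNbhd] at hk
    exact ⟨hbob k (mem_closedNbhd.2 (Or.inr hk.1)) hk.2.le, hk.2.ne⟩

theorem execAll_run_log (φ : P.AliceAngles) (ψ : P.OscarAngles) (κ : P.Keys)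
    (α : P.AliceAngles) (β : P.OscarAngles) (ω : P.Outcomes) :
    execAll (heldByAlice P.G.I) (run φ ψ κ α β ω).log = some (heldByAlice P.G.O) := by
  have key := sort_univ_induction (V := V) (motive := fun S l =>
    execAll (P.holders ∅) (l.flatMap (roundCommands φ ψ κ α β ω)) = some (P.holders S))
    (by simp [execAll]) (by
      intro l i ih
      rw [List.flatMap_append, execAll_append, ih]
      simpa using execAll_round φ ψ κ α β ω i)
  rw [run_log, execAll_append, execAll_inputs, Option.bind_some, key]
  congr 1
  ext1 v
  simp [holders, heldByAlice]

end PublicInfo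

/-! ### Tensor products of single-qubit operators -/

section Tensor

variable {V : Type*} [Fintype V]

/-- The tensor product of the single-qubit operators `A k`. -/
def tensorOp (A : V → Matrix (ZMod 2) (ZMod 2) ℂ) : Matrix (V → ZMod 2) (V → ZMod 2) ℂ :=
  fun x y => ∏ k, A k (x k) (y k)

lemma tensorOp_one : tensorOp (fun _ : V => 1) = 1 := by
  classical
  ext x y
  simp only [tensorOp, Matrix.one_apply, Finset.prod_ite_zero, Finset.prod_const_one,
    Finset.mem_univ, true_imp_iff, funext_iff]

variable [DecidableEq V]

lemma tensorOp_mul (A B : V → Matrix (ZMod 2) (ZMod 2) ℂ) :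
    tensorOp A * tensorOp B = tensorOp fun k => A k * B k := by
  ext x y
  simp only [tensorOp, Matrix.mul_apply, ← Finset.prod_mul_distrib, Finset.prod_univ_sum,
    Fintype.piFinset_univ]

lemma onSite_eq_tensorOp (k : V) (M : Matrix (ZMod 2) (ZMod 2) ℂ) :
    onSite k M = tensorOp (Function.update (fun _ => 1) k M) := by
  ext x y
  rw [tensorOp, Fintype.prod_eq_mul_prod_compl k, Function.update_self]
  have : ∏ j ∈ {k}ᶜ, Function.update (fun _ => (1 : Matrix (ZMod 2) (ZMod 2) ℂ)) k M j (x j) (y j)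
      = ∏ j ∈ {k}ᶜ, if x j = y j then 1 else 0 := by
    refine Finset.prod_congr rfl fun j hj => ?_
    rw [Function.update_of_ne (by simpa using hj), Matrix.one_apply]
  rw [this, Finset.prod_ite_zero]
  simp [onSite]

lemma onSite_mul_onSite (k : V) (M N : Matrix (ZMod 2) (ZMod 2) ℂ) :
    onSite k M * onSite k N = onSite k (M * N) := by
  simp only [onSite_eq_tensorOp, tensorOp_mul]
  congr 1
  ext1 j
  by_cases hj : j = k
  · subst hj; simp
  · simp [hj]

/-- An entry of the tensor product vanishes unless row and column agree wherever the factor is the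
identity, and on such pairs `F` is constant. This supplies the commutations past CPHASE gates below.
-/
lemma tensorOp_mul_diagonal_comm {A : V → Matrix (ZMod 2) (ZMod 2) ℂ} {F : (V → ZMod 2) → ℂ}
    (h : ∀ x y, (∀ k, A k = 1 → x k = y k) → F x = F y) :
    tensorOp A * Matrix.diagonal F = Matrix.diagonal F * tensorOp A := by
  ext x y
  rw [Matrix.mul_diagonal, Matrix.diagonal_mul]
  by_cases hxy : ∀ k, A k = 1 → x k = y k
  · rw [h x y hxy, mul_comm]
  · push Not at hxy
    obtain ⟨k, hk, hne⟩ := hxy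
    have : tensorOp A x y = 0 :=
      Finset.prod_eq_zero (Finset.mem_univ k) (by rw [hk, Matrix.one_apply_ne hne])
    simp [this]

lemma commandsOp_flatMap {g : V → List (Command V)} {M : V → Matrix (ZMod 2) (ZMod 2) ℂ}
    (hg : ∀ k, commandsOp (g k) = onSite k (M k)) {l : List V} (hl : l.Nodup) :
    commandsOp (l.flatMap g) = tensorOp fun k => if k ∈ l then M k else 1 := by
  induction l with
  | nil => simp [commandsOp, tensorOp_one]
  | cons k l ih =>
    obtain ⟨hk, hl⟩ := List.nodup_cons.1 hl
    rw [List.flatMap_cons, commandsOp_append, ih hl, hg, onSite_eq_tensorOp, tensorOp_mul]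
    congr 1
    ext1 j
    by_cases hj : j = k
    · subst hj; simp [hk]
    · simp [hj]

lemma commandsOp_cz (p : Party) (i : V) {l : List V} (hl : l.Nodup) :
    commandsOp (l.map (Command.cz p i)) =
      Matrix.diagonal fun x => ∏ k ∈ l.toFinset, czPhase (x i) (x k) := by
  induction l with
  | nil => simp [commandsOp]
  | cons k l ih =>
    obtain ⟨hk, hl⟩ := List.nodup_cons.1 hl
    simp only [List.map_cons, commandsOp, ih hl, Command.op, czGate, Matrix.diagonal_mul_diagonal,
      List.toFinset_cons]
    congr 1
    ext1 x
    rw [Finset.prod_insert (by simpa using hk), mul_comm]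

end Tensor

namespace PublicInfo

variable {V : Type*} [Fintype V] [LinearOrder V] {P : PublicInfo V}

/-! ### The operator of a run -/

/-- The angles of Alice and Oscar, on all nodes. -/
def nodeAngle (φ : P.AliceAngles) (ψ : P.OscarAngles) (i : V) : ℝ :=
  if i ∈ P.VA then aliceExt φ i else oscarExt ψ i

/-- Angle zero at outputs lets Bob's `|+⟩` and the unrotated input-outputs fit the same formulas as
the other nodes. -/
lemma nodeAngle_of_mem_O (φ : P.AliceAngles) (ψ : P.OscarAngles) {i : V} (hi : i ∈ P.G.O) :
    nodeAngle φ ψ i = 0 := by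
  simp [nodeAngle, mem_VA_of_mem_O hi, aliceExt, hi]

lemma nodeAngle_of_mem_I (φ : P.AliceAngles) (ψ : P.OscarAngles) {i : V} (hi : i ∈ P.G.I) :
    nodeAngle φ ψ i = aliceExt φ i := by
  have : i ∈ P.VA ∪ P.VO := P.cover ▸ Finset.mem_univ i
  simp [nodeAngle, (Finset.mem_union.1 this).resolve_right
    (Finset.disjoint_left.1 P.input_alice hi)]

/-- The angle `δ_i` sent to Bob. -/
def sentAngle (φ : P.AliceAngles) (ψ : P.OscarAngles) (κ : P.Keys) (α : P.AliceAngles)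
    (β : P.OscarAngles) (ω : P.Outcomes) (i : V) : ℝ :=
  if i ∈ P.VA then
    delta κ (aliceExt α) ⟨encryptedAngle P.VA κ (aliceExt φ), signals κ ω⟩ i
  else delta κ (oscarExt β) ⟨encryptedAngle P.VO κ (oscarExt ψ), signals κ ω⟩ i

/-- The single-qubit operator that finishes the round of node `i`. -/
def finishOp (φ : P.AliceAngles) (ψ : P.OscarAngles) (κ : P.Keys) (α : P.AliceAngles)
    (β : P.OscarAngles) (ω : P.Outcomes) (i : V) : Matrix (ZMod 2) (ZMod 2) ℂ :=
  if h : i ∉ P.G.O then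
    Matrix.vecMulVec zeroKet
      (star (plusKet (sentAngle φ ψ κ α β ω i + ((ω ⟨i, h⟩).val : ℝ) * Real.pi)))
  else pauliX ^ (P.invSignal (signals κ ω) i + keyT κ i).val *
    pauliZ ^ (P.zSignal (signals κ ω) i + tSignal κ i).val

/-- The single-qubit operator that encrypts or prepares the qubit at node `i`. -/
def startOp (κ : P.Keys) (α : P.AliceAngles) (β : P.OscarAngles) (i : V) :
    Matrix (ZMod 2) (ZMod 2) ℂ :=
  if i ∈ P.G.I then rotZ (nodeAngle α β i) * pauliX ^ (keyT κ i).val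
  else Matrix.vecMulVec (plusKet (nodeAngle α β i)) (star zeroKet)

lemma commandsOp_finish (φ : P.AliceAngles) (ψ : P.OscarAngles) (κ : P.Keys) (α : P.AliceAngles)
    (β : P.OscarAngles) (ω : P.Outcomes) (i : V) :
    commandsOp (finishCommands φ ψ κ α β ω i) = onSite i (finishOp φ ψ κ α β ω i) := by
  unfold finishCommands finishOp sentAngle
  split_ifs <;> simp [measureCommands, outputCommands, commandsOp, Command.op, onSite_mul_onSite]

lemma commandsOp_prepare (α : P.AliceAngles) (β : P.OscarAngles) (k : V) :
    commandsOp (prepareCommands α β k) =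
      onSite k (Matrix.vecMulVec (plusKet (nodeAngle α β k)) (star zeroKet)) := by
  unfold prepareCommands
  split_ifs with hO hA
  · simp [commandsOp, Command.op, nodeAngle_of_mem_O α β hO]
  · simp [commandsOp, Command.op, nodeAngle, hA]
  · simp [commandsOp, Command.op, nodeAngle, hA]

lemma commandsOp_inputs (κ : P.Keys) (α : P.AliceAngles) (β : P.OscarAngles) :
    commandsOp (P.G.I.sort.flatMap (inputCommands κ α)) =
      tensorOp fun k => if k ∈ P.G.I then startOp κ α β k else 1 := by
  rw [commandsOp_flatMap (M := fun k => rotZ (aliceExt α k) * pauliX ^ (keyT κ k).val) _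
    (Finset.sort_nodup _ _)]
  · congr 1
    ext1 k
    by_cases hk : k ∈ P.G.I <;> simp [hk, startOp, nodeAngle_of_mem_I α β]
  · intro k
    simp [inputCommands, commandsOp, Command.op, onSite_mul_onSite]

variable (P) in
/-- CPHASE along the edges whose first endpoint lies in `S`. -/
def edgePhase (S : Finset V) (x : V → ZMod 2) : ℂ :=
  ∏ i ∈ S, ∏ k ∈ P.laterNbhd i, czPhase (x i) (x k)

lemma edgePhase_empty : Matrix.diagonal (P.edgePhase ∅) = 1 := by
  rw [← Matrix.diagonal_one]
  rfl

lemma entangleAll_eq : P.entangleAll = Matrix.diagonal (P.edgePhase Finset.univ) := by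
  classical
  unfold entangleAll
  congr 1
  ext1 x
  rw [edgePhase, Finset.prod_filter, ← Finset.univ_product_univ, Finset.prod_product]
  refine Finset.prod_congr rfl fun i _ => ?_
  rw [laterNbhd, Finset.prod_filter]
  refine Finset.prod_congr rfl fun k _ => ?_
  simp only [and_comm]

-- The new round multiplies on the left by preparations, then CPHASEs, then the finishing operator.
-- Each must be moved right into its own layer. Fresh sites lie in no earlier neighbourhood, so the
-- preparations pass the earlier gates and finishing operators. The new CPHASEs involve only sites
-- from `i` on, so they pass the operators at finished sites.
open Classical in
lemma commandsOp_round (φ : P.AliceAngles) (ψ : P.OscarAngles) (κ : P.Keys) (α : P.AliceAngles)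
    (β : P.OscarAngles) (ω : P.Outcomes) {i : V} {S : Finset V}
    (hS : S = Finset.univ.filter (· < i)) :
    commandsOp (roundCommands φ ψ κ α β ω i) *
      (tensorOp (fun k => if k ∈ S then finishOp φ ψ κ α β ω k else 1) *
        Matrix.diagonal (P.edgePhase S) *
        tensorOp (fun k => if k ∈ P.G.I ∨ ∃ j ∈ S, k ∈ P.closedNbhd j then startOp κ α β k
          else 1)) =
      tensorOp (fun k => if k ∈ insert i S then finishOp φ ψ κ α β ω k else 1) *
        Matrix.diagonal (P.edgePhase (insert i S)) *
        tensorOp (fun k => if k ∈ P.G.I ∨ ∃ j ∈ insert i S, k ∈ P.closedNbhd j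
          then startOp κ α β k else 1) := by
  have hmem : ∀ k, k ∈ S ↔ k < i := by simp [hS]
  have hiS : i ∉ S := by simp [hmem]
  set B : V → Matrix (ZMod 2) (ZMod 2) ℂ := fun k =>
    if k ∈ (P.fresh i).sort then Matrix.vecMulVec (plusKet (nodeAngle α β k)) (star zeroKet)
    else 1 with hB
  set A : V → Matrix (ZMod 2) (ZMod 2) ℂ := fun k =>
    if k ∈ S then finishOp φ ψ κ α β ω k else 1 with hA
  have hAne : ∀ k, i ≤ k → A k = 1 := fun k hk => by simp [hA, hmem, not_lt.2 hk]
  have hBne : ∀ k, k ∉ P.fresh i → B k = 1 := fun k hk => by simp [hB, hk]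
  have hBA : tensorOp B * tensorOp A = tensorOp A * tensorOp B := by
    rw [tensorOp_mul, tensorOp_mul]
    congr 1
    ext1 k
    by_cases hk : k ∈ P.fresh i
    · simp [hAne k (not_lt.1 (not_lt_of_mem_fresh hk))]
    · simp [hBne k hk]
  have hBE : tensorOp B * Matrix.diagonal (P.edgePhase S) =
      Matrix.diagonal (P.edgePhase S) * tensorOp B := by
    refine tensorOp_mul_diagonal_comm fun x y hxy => ?_
    refine Finset.prod_congr rfl fun j hj => Finset.prod_congr rfl fun k hk => ?_
    rw [hxy j (hBne j fun h => (mem_fresh.1 h).2.2 j ((hmem j).1 hj)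
        (mem_closedNbhd.2 (Or.inl rfl))),
      hxy k (hBne k fun h => (mem_fresh.1 h).2.2 j ((hmem j).1 hj)
        (mem_closedNbhd.2 (Or.inr (mem_laterNbhd.1 hk).1)))]
  have hCA : (Matrix.diagonal fun x => ∏ k ∈ P.laterNbhd i, czPhase (x i) (x k)) * tensorOp A =
      tensorOp A * Matrix.diagonal fun x => ∏ k ∈ P.laterNbhd i, czPhase (x i) (x k) := by
    refine (tensorOp_mul_diagonal_comm fun x y hxy => ?_).symm
    refine Finset.prod_congr rfl fun k hk => ?_
    rw [hxy i (hAne i le_rfl), hxy k (hAne k (mem_laterNbhd.1 hk).2.le)]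
  have hFA : onSite i (finishOp φ ψ κ α β ω i) * tensorOp A =
      tensorOp (fun k => if k ∈ insert i S then finishOp φ ψ κ α β ω k else 1) := by
    rw [onSite_eq_tensorOp, tensorOp_mul]
    congr 1
    ext1 k
    by_cases hk : k = i
    · subst hk; simp [hA, hiS]
    · simp [hA, hk]
  have hBP : tensorOp B * tensorOp (fun k => if k ∈ P.G.I ∨ ∃ j ∈ S, k ∈ P.closedNbhd j
        then startOp κ α β k else 1) =
      tensorOp (fun k => if k ∈ P.G.I ∨ ∃ j ∈ insert i S, k ∈ P.closedNbhd j
          then startOp κ α β k else 1) := by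
    rw [tensorOp_mul]
    congr 1
    ext1 k
    by_cases hk : k ∈ P.fresh i
    · have h := mem_fresh.1 hk
      have h1 : ¬ (k ∈ P.G.I ∨ ∃ j ∈ S, k ∈ P.closedNbhd j) := by
        rintro (h' | ⟨j, hj, h'⟩)
        · exact h.2.1 h'
        · exact h.2.2 j ((hmem j).1 hj) h'
      have h2 : k ∈ P.G.I ∨ ∃ j ∈ insert i S, k ∈ P.closedNbhd j := by
        simp [h.1]
      rw [if_neg h1, if_pos h2, mul_one]
      simp [hB, hk, startOp, h.2.1]
    · have h1 : (k ∈ P.G.I ∨ ∃ j ∈ insert i S, k ∈ P.closedNbhd j) ↔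
          (k ∈ P.G.I ∨ ∃ j ∈ S, k ∈ P.closedNbhd j) := by
        refine ⟨?_, by simp; tauto⟩
        intro h
        by_contra hcon
        push Not at hcon
        rcases h with h | ⟨j, hj, h⟩
        · exact hcon.1 h
        rcases Finset.mem_insert.1 hj with rfl | hj
        · exact hk (mem_fresh.2 ⟨h, hcon.1, fun j hj => hcon.2 j ((hmem j).2 hj)⟩)
        · exact hcon.2 j hj h
      simp only [h1, hBne k hk, one_mul]
  have hE : (Matrix.diagonal fun x => ∏ k ∈ P.laterNbhd i, czPhase (x i) (x k)) *
      Matrix.diagonal (P.edgePhase S) = Matrix.diagonal (P.edgePhase (insert i S)) := by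
    rw [Matrix.diagonal_mul_diagonal]
    congr 1
    ext1 x
    rw [edgePhase, edgePhase, Finset.prod_insert hiS]
  rw [roundCommands, commandsOp_append, commandsOp_append, commandsOp_finish,
    commandsOp_flatMap (commandsOp_prepare α β) (Finset.sort_nodup _ _),
    commandsOp_cz _ _ (Finset.sort_nodup _ _), Finset.sort_toFinset, ← hFA, ← hBP, ← hE]
  change _ * (_ * tensorOp B) * _ = _
  simp only [Matrix.mul_assoc]
  congr 1
  simp only [← Matrix.mul_assoc]
  rw [← hCA]
  simp only [Matrix.mul_assoc]
  congr 1
  simp only [← Matrix.mul_assoc]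
  rw [hBA]
  simp only [Matrix.mul_assoc]
  congr 1
  simp only [← Matrix.mul_assoc]
  rw [hBE]

theorem commandsOp_run_log (φ : P.AliceAngles) (ψ : P.OscarAngles) (κ : P.Keys)
    (α : P.AliceAngles) (β : P.OscarAngles) (ω : P.Outcomes) :
    commandsOp (run φ ψ κ α β ω).log =
      tensorOp (finishOp φ ψ κ α β ω) * P.entangleAll * tensorOp (startOp κ α β) := by
  classical
  have key := sort_univ_induction (V := V) (motive := fun S l =>
    commandsOp (P.G.I.sort.flatMap (inputCommands κ α) ++
      l.flatMap (roundCommands φ ψ κ α β ω)) =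
      tensorOp (fun k => if k ∈ S then finishOp φ ψ κ α β ω k else 1) *
        Matrix.diagonal (P.edgePhase S) *
        tensorOp (fun k => if k ∈ P.G.I ∨ ∃ j ∈ S, k ∈ P.closedNbhd j then startOp κ α β k
          else 1))
    (by simp [commandsOp_inputs κ α β, tensorOp_one, edgePhase_empty]) (by
      intro l i ih
      rw [List.flatMap_append, ← List.append_assoc, commandsOp_append, ih]
      rw [List.flatMap_singleton]
      exact commandsOp_round φ ψ κ α β ω rfl)
  rw [run_log, key, entangleAll_eq]
  congr 2
  · simp
  · ext1 k
    rw [if_pos (Or.inr ⟨k, Finset.mem_univ k, mem_closedNbhd.2 (Or.inl rfl)⟩)]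

end PublicInfo

/-! ### Phases -/

/-- `e^{iθ}`. -/
def cis (θ : ℝ) : ℂ := Complex.exp (Complex.I * θ)

/-- `(-1) ^ a` as a complex number. -/
def bitPhase (a : ZMod 2) : ℂ := if a = 0 then 1 else -1

/-- `z ^ ((-1) ^ a)`. -/
def bitInv (a : ZMod 2) (z : ℂ) : ℂ := if a = 0 then z else z⁻¹

lemma bit_cases (a : ZMod 2) : a = 0 ∨ a = 1 := by
  revert a; decide

lemma bit_val_one : (1 : ZMod 2).val = 1 := rfl

lemma bit_one_add_one : (1 + 1 : ZMod 2) = 0 := rfl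

@[simp] lemma bitPhase_zero : bitPhase 0 = 1 := by simp [bitPhase]

@[simp] lemma bitPhase_one : bitPhase 1 = -1 := by simp [bitPhase]

@[simp] lemma bitInv_zero (z : ℂ) : bitInv 0 z = z := by simp [bitInv]

@[simp] lemma bitInv_one (z : ℂ) : bitInv 1 z = z⁻¹ := by simp [bitInv]

lemma bitPhase_add (a b : ZMod 2) : bitPhase (a + b) = bitPhase a * bitPhase b := by
  rcases bit_cases a with rfl | rfl <;> rcases bit_cases b with rfl | rfl <;>
    simp [bit_one_add_one]

lemma bitPhase_sum {ι : Type*} (s : Finset ι) (g : ι → ZMod 2) :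
    bitPhase (∑ i ∈ s, g i) = ∏ i ∈ s, bitPhase (g i) := by
  classical
  induction s using Finset.induction_on with
  | empty => simp
  | insert i s hi ih => rw [Finset.sum_insert hi, Finset.prod_insert hi, bitPhase_add, ih]

lemma norm_bitPhase (a : ZMod 2) : ‖bitPhase a‖ = 1 := by
  rcases bit_cases a with rfl | rfl <;> simp

/-- A sign is its own inverse, so adding multiples of `π` commutes with negating the angle. -/
lemma bitInv_mul_bitPhase (a b : ZMod 2) (z : ℂ) :
    bitInv a (z * bitPhase b) = bitInv a z * bitPhase b := by
  rcases bit_cases a with rfl | rfl <;> rcases bit_cases b with rfl | rfl <;>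
    simp [inv_neg]

lemma bitInv_add (a b : ZMod 2) (z : ℂ) : bitInv (a + b) z = bitInv a (bitInv b z) := by
  rcases bit_cases a with rfl | rfl <;> rcases bit_cases b with rfl | rfl <;>
    simp [bit_one_add_one]

lemma cis_add (θ η : ℝ) : cis (θ + η) = cis θ * cis η := by
  simp [cis, mul_add, Complex.exp_add]

lemma cis_ne_zero (θ : ℝ) : cis θ ≠ 0 := Complex.exp_ne_zero _

@[simp] lemma cis_zero : cis 0 = 1 := by simp [cis]

lemma norm_cis (θ : ℝ) : ‖cis θ‖ = 1 := by
  rw [cis, mul_comm, Complex.norm_exp_ofReal_mul_I]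

lemma star_cis (θ : ℝ) : star (cis θ) = (cis θ)⁻¹ := by
  rw [Complex.inv_eq_conj (norm_cis θ)]; rfl

lemma cis_bit_mul_pi (a : ZMod 2) : cis ((a.val : ℝ) * Real.pi) = bitPhase a := by
  rcases bit_cases a with rfl | rfl
  · simp
  · simp [cis, bit_val_one, mul_comm Complex.I]

lemma cis_bitSign_mul (a : ZMod 2) (θ : ℝ) : cis (bitSign a * θ) = bitInv a (cis θ) := by
  rcases bit_cases a with rfl | rfl
  · simp [bitSign]
  · simp [bitSign, bit_val_one, cis, Complex.exp_neg]

lemma plusKet_apply (θ : ℝ) (a : ZMod 2) :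
    plusKet θ a = ((1 / Real.sqrt 2 : ℝ) : ℂ) * cis θ ^ a.val := by
  rcases bit_cases a with rfl | rfl <;> simp [plusKet, cis, bit_val_one]

lemma czPhase_eq (a c : ZMod 2) : czPhase a c = bitPhase (a * c) := by
  rcases bit_cases a with rfl | rfl <;> rcases bit_cases c with rfl | rfl <;> simp [czPhase]

lemma sum_bit {M : Type*} [AddCommMonoid M] (g : ZMod 2 → M) : ∑ a, g a = g 0 + g 1 :=
  Fin.sum_univ_two g

lemma rotZ_mul_pauliX_apply (θ : ℝ) (t u x : ZMod 2) :
    (rotZ θ * pauliX ^ t.val) u x = cis θ ^ u.val * if u = x + t then 1 else 0 := by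
  rw [rotZ, Matrix.diagonal_mul]
  rcases bit_cases t with rfl | rfl <;> rcases bit_cases u with rfl | rfl <;>
    simp [bit_val_one, cis, pauliX, Matrix.one_apply]

lemma pauliX_mul_pauliZ_apply (a b y u : ZMod 2) :
    (pauliX ^ a.val * pauliZ ^ b.val) y u = (if y = u + a then 1 else 0) * bitPhase (b * u) := by
  rw [pauliZ, Matrix.diagonal_pow, Matrix.mul_diagonal]
  rcases bit_cases a with rfl | rfl <;> rcases bit_cases b with rfl | rfl <;>
    rcases bit_cases u with rfl | rfl <;> simp [bit_val_one, pauliX, Matrix.one_apply]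

/-- The one-site core of blindness and correctness: the mask `η` cancels between preparation and
measurement, negating `θ` compensates the flip of the bit by `a`, and the shift by `bπ` leaves the
sign `(-1)^(wb)`, up to a factor free of `w`. -/
lemma star_bitInv_pow_mul (a b w : ZMod 2) (θ η : ℝ) :
    star ((bitInv a (cis θ) * bitPhase b * cis η) ^ (w + a).val) * cis η ^ (w + a).val =
      (bitPhase (b * a) * if a = 1 then cis θ else 1) * bitPhase (w * b) *
        star (cis θ ^ w.val) := by
  have h1 := cis_ne_zero θ
  have h2 := cis_ne_zero η
  rcases bit_cases a with rfl | rfl <;> rcases bit_cases b with rfl | rfl <;>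
    rcases bit_cases w with rfl | rfl <;>
    simp [bit_val_one, bit_one_add_one, star_cis, -RCLike.star_def, -Complex.star_def] <;> field_simp

/-! ### Qubits placed in a register -/

section Embed

variable {V : Type*} [Fintype V] [DecidableEq V]

/-- A bit string on `S`, extended by zero. -/
def extendBits {S : Finset V} (y : S → ZMod 2) (i : V) : ZMod 2 :=
  if h : i ∈ S then y ⟨i, h⟩ else 0

lemma embed_apply {S : Finset V} (x : V → ZMod 2) (y : S → ZMod 2) :
    embed S x y = if x = extendBits y then 1 else 0 := by
  unfold embed
  congr 1
  rw [eq_iff_iff, funext_iff]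
  constructor
  · rintro ⟨h1, h2⟩ i
    by_cases hi : i ∈ S
    · simp [extendBits, hi, ← h1 ⟨i, hi⟩]
    · simp [extendBits, hi, h2 i hi]
  · intro h
    exact ⟨fun i => by simp [h, extendBits], fun i hi => by simp [h, extendBits, hi]⟩

lemma mul_embed_apply {S : Finset V} {m : Type*} (T : Matrix m (V → ZMod 2) ℂ) (w : m)
    (x : S → ZMod 2) : (T * embed S) w x = T w (extendBits x) := by
  simp [Matrix.mul_apply, embed_apply]

lemma embed_conjTranspose_mul_apply {S : Finset V} {m : Type*} (T : Matrix (V → ZMod 2) m ℂ)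
    (y : S → ZMod 2) (w : m) : ((embed S)ᴴ * T) y w = T (extendBits y) w := by
  simp [Matrix.mul_apply, embed_apply, apply_ite (star : ℂ → ℂ)]

end Embed

namespace PublicInfo

variable {V : Type*} [Fintype V] [LinearOrder V] {P : PublicInfo V}

/-- Puts the bra and ket layers of the pattern into sitewise form, for comparison with `tensorOp`.
-/
lemma prod_ite_mem_eq (S : Finset V) (w : V → ZMod 2) (y : S → ZMod 2) (g : V → ℂ) :
    (if ∀ i : S, w i = y i then ∏ k ∈ Sᶜ, g k else 0) =
      ∏ k, if k ∈ S then if w k = extendBits y k then 1 else 0 else g k := by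
  have hiff : (∀ i : S, w i = y i) ↔ ∀ k ∈ S, w k = extendBits y k := by
    refine ⟨fun h k hk => by simpa [extendBits, hk] using h ⟨k, hk⟩, fun h i => ?_⟩
    simpa [extendBits] using h i i.2
  have h1 : (∏ k ∈ S, if k ∈ S then if w k = extendBits y k then 1 else 0 else g k) =
      ∏ k ∈ S, if w k = extendBits y k then 1 else 0 :=
    Finset.prod_congr rfl fun k hk => if_pos hk
  have h2 : (∏ k ∈ Sᶜ, if k ∈ S then if w k = extendBits y k then 1 else 0 else g k) =
      ∏ k ∈ Sᶜ, g k :=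
    Finset.prod_congr rfl fun k hk => if_neg (Finset.mem_compl.1 hk)
  rw [← Finset.prod_mul_prod_compl S, h1, h2, Finset.prod_ite_zero]
  simp only [hiff, Finset.prod_const_one, ite_mul, one_mul, zero_mul]

/-! ### The flow theorem -/

/-- On the level of `e^{iθ}` the updates for different inputs commute, so only the node's own flip
and the total sign from its neighbours remain. -/
lemma cis_foldl_updateAngles (own : Finset V) (κ : P.Keys) {l : List V} (hl : l.Nodup)
    (m : Memory V) {j : V} (hj : j ∈ own) [DecidableRel P.G.graph.Adj] :
    cis ((l.foldl (fun m k => updateAngles own κ k m) m).angle j) =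
      bitInv (if j ∈ l then keyT κ j else 0) (cis (m.angle j)) *
        bitPhase (∑ k ∈ l.toFinset, if P.G.graph.Adj k j then keyT κ k else 0) := by
  induction l generalizing m with
  | nil => simp
  | cons k l ih =>
    obtain ⟨hk, hl⟩ := List.nodup_cons.1 hl
    rw [List.foldl_cons, ih hl, List.toFinset_cons, Finset.sum_insert (by simpa using hk),
      bitPhase_add, ← mul_assoc]
    congr 1
    by_cases hjk : j = k
    · subst hjk
      simp [updateAngles, hj, hk, cis_bitSign_mul]
    · by_cases hadj : P.G.graph.Adj k j
      · simp [updateAngles, hj, hjk, hadj, cis_add, bitInv_mul_bitPhase, cis_bit_mul_pi,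
          -ZMod.natCast_val]
      · simp [updateAngles, hj, hjk, hadj]

lemma tSignal_eq (κ : P.Keys) (i : V) [DecidableRel P.G.graph.Adj] :
    tSignal κ i = ∑ k ∈ P.G.I, if P.G.graph.Adj k i then keyT κ k else 0 := by
  rw [tSignal, ← Finset.sum_coe_sort P.G.I fun k => if P.G.graph.Adj k i then keyT κ k else 0]
  refine Finset.sum_congr rfl fun k _ => ?_
  have : keyT κ (k : V) = κ.2 k := by simp [keyT]
  rw [this]
  congr

lemma cis_encryptedAngle (own : Finset V) (κ : P.Keys) (γ : V → ℝ) {j : V} (hj : j ∈ own) :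
    cis (encryptedAngle own κ γ j) =
      bitInv (keyT κ j) (cis (γ j)) * bitPhase (tSignal κ j) := by
  classical
  rw [encryptedAngle, cis_foldl_updateAngles own κ (Finset.sort_nodup _ _) _ hj, tSignal_eq,
    Finset.sort_toFinset]
  by_cases h : j ∈ P.G.I <;> simp [h, keyT]

/-- The exponent of the byproduct `X` at node `i`. -/
def byproductX (κ : P.Keys) (ω : P.Outcomes) (i : V) : ZMod 2 :=
  P.invSignal (signals κ ω) i + keyT κ i

/-- The exponent of the byproduct `Z` at node `i`. -/
def byproductZ (κ : P.Keys) (ω : P.Outcomes) (i : V) : ZMod 2 :=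
  P.zSignal (signals κ ω) i + tSignal κ i + signals κ ω i

lemma invSignal_of_mem_I (s : V → ZMod 2) {i : V} (hi : i ∈ P.G.I) : P.invSignal s i = 0 := by
  refine Finset.sum_eq_zero fun j _ => if_neg ?_
  rintro rfl
  exact (P.flow.f j).2 hi

/-- The shift `ω_i π` selecting the observed basis vector combines with `r_i π` into the sign of the
true signal `s_i`, which is why `s_i` enters `byproductZ`. -/
lemma cis_delta (own : Finset V) (κ : P.Keys) (γ φ : V → ℝ) (ω : P.Outcomes) {i : V}
    (hi : i ∉ P.G.O) (how : i ∈ own) :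
    cis (delta κ γ ⟨encryptedAngle own κ φ, signals κ ω⟩ i + ((ω ⟨i, hi⟩).val : ℝ) * Real.pi) =
      bitInv (byproductX κ ω i) (cis (φ i)) * bitPhase (byproductZ κ ω i) * cis (γ i) := by
  rw [delta, mul_comm Real.pi]
  simp only [cis_add, cis_bit_mul_pi, cis_bitSign_mul, cis_encryptedAngle own κ φ how,
    bitInv_mul_bitPhase, byproductX, byproductZ, bitInv_add, bitPhase_add, signals, hi,
    not_false_eq_true, dite_true]
  ring

lemma mem_VO_of_not_mem_VA {i : V} (hi : i ∉ P.VA) : i ∈ P.VO := by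
  have : i ∈ P.VA ∪ P.VO := P.cover ▸ Finset.mem_univ i
  exact (Finset.mem_union.1 this).resolve_left hi

lemma cis_sentAngle (φ : P.AliceAngles) (ψ : P.OscarAngles) (κ : P.Keys) (α : P.AliceAngles)
    (β : P.OscarAngles) (ω : P.Outcomes) {i : V} (hi : i ∉ P.G.O) :
    cis (sentAngle φ ψ κ α β ω i + ((ω ⟨i, hi⟩).val : ℝ) * Real.pi) =
      bitInv (byproductX κ ω i) (cis (nodeAngle φ ψ i)) * bitPhase (byproductZ κ ω i) *
        cis (nodeAngle α β i) := by
  unfold sentAngle nodeAngle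
  split_ifs with hA
  · exact cis_delta _ _ _ _ _ hi hA
  · exact cis_delta _ _ _ _ _ hi (mem_VO_of_not_mem_VA hA)

/-- The correction structure of a flow: the `Z` byproduct at a node is the sum of the `X`
byproducts at its neighbours. -/
lemma sum_byproductX (κ : P.Keys) (ω : P.Outcomes) (i : V) [DecidableRel P.G.graph.Adj] :
    ∑ k, (if P.G.graph.Adj i k then byproductX κ ω k else 0) = byproductZ κ ω i := by
  have h1 : ∑ k, (if P.G.graph.Adj i k then keyT κ k else 0) = tSignal κ i := by
    rw [tSignal_eq]
    symm
    refine Finset.sum_subset_zero_on_sdiff (Finset.subset_univ _) ?_ ?_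
    · intro k hk
      have : k ∉ P.G.I := by simpa using hk
      simp [keyT, this]
    · intro k _
      simp only [P.G.graph.adj_comm]
  have h2 : ∑ k, (if P.G.graph.Adj i k then P.invSignal (signals κ ω) k else 0) =
      P.zSignal (signals κ ω) i + signals κ ω i := by
    have h3 : signals κ ω i = ∑ j : {j // j ∉ P.G.O}, if (j : V) = i then signals κ ω j else 0 := by
      by_cases hi : i ∈ P.G.O
      · rw [Finset.sum_eq_zero]
        · simp [signals, hi]
        · intro j _
          rw [if_neg]
          rintro rfl
          exact j.2 hi
      · rw [Finset.sum_eq_single ⟨i, hi⟩]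
        · simp
        · intro j _ hj
          exact if_neg fun h => hj (Subtype.ext h)
        · simp
    have h4 : ∀ k, (if P.G.graph.Adj i k then P.invSignal (signals κ ω) k else 0) =
        ∑ j : {j // j ∉ P.G.O}, if (P.flow.f j : V) = k then
          if P.G.graph.Adj i k then signals κ ω j else 0 else 0 := by
      intro k
      by_cases hk : P.G.graph.Adj i k <;> simp [hk, invSignal]
    rw [Finset.sum_congr rfl fun k _ => h4 k, Finset.sum_comm, zSignal]
    conv_rhs => rw [h3]
    rw [← Finset.sum_add_distrib]
    refine Finset.sum_congr rfl fun j _ => ?_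
    rw [Finset.sum_ite_eq, if_pos (Finset.mem_univ _)]
    -- For `j = i`, `F0` makes `f i` a neighbour of `i`, which yields `s_i`, while irreflexivity
    -- keeps this term out of `z(i)`. For `j ≠ i` with `f j` adjacent to `i`, `F2` gives `j ≺ i`, so
    -- the order condition in `z(i)` is automatic.
    have hirr : ∀ v, ¬ P.flow.prec v v := P.flow.strictOrder.irrefl
    by_cases hji : (j : V) = i
    · have : P.G.graph.Adj i (P.flow.f j) := hji ▸ P.flow.F0 j
      simp [← hji, hirr, P.flow.F0 j]
    · by_cases hadj : P.G.graph.Adj i (P.flow.f j)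
      · have := P.flow.F2 j i hadj.symm (Ne.symm hji)
        simp [hadj, hadj.symm, this, hji]
      · have : ¬ P.G.graph.Adj (P.flow.f j) i := fun h => hadj h.symm
        simp [hadj, this, hji]
  rw [byproductZ, add_right_comm, ← h2, ← h1, ← Finset.sum_add_distrib]
  refine Finset.sum_congr rfl fun k _ => ?_
  split_ifs <;> simp [byproductX]

/-- Each edge has exactly one increasing orientation, so pairing `g i k` with `g k i` counts all
ordered adjacent pairs once. -/
lemma prod_laterNbhd_symm (g : V → V → ℂ) [DecidableRel P.G.graph.Adj] :
    ∏ i, ∏ k ∈ P.laterNbhd i, (g i k * g k i) =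
      ∏ i, ∏ k, if P.G.graph.Adj i k then g i k else 1 := by
  have h1 : ∀ h : V → V → ℂ, ∏ i, ∏ k ∈ P.laterNbhd i, h i k =
      ∏ i, ∏ k, if P.G.graph.Adj i k ∧ i < k then h i k else 1 := by
    intro h
    refine Finset.prod_congr rfl fun i _ => ?_
    rw [laterNbhd, Finset.prod_filter]
    refine Finset.prod_congr rfl fun k _ => ?_
    congr
  simp only [Finset.prod_mul_distrib]
  rw [h1 g, h1 fun i k => g k i, Finset.prod_comm (f := fun i k =>
    if P.G.graph.Adj i k ∧ i < k then g k i else 1), ← Finset.prod_mul_distrib]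
  refine Finset.prod_congr rfl fun i _ => ?_
  rw [← Finset.prod_mul_distrib]
  refine Finset.prod_congr rfl fun k _ => ?_
  by_cases hadj : P.G.graph.Adj i k
  · have hadj' := hadj.symm
    rcases lt_or_gt_of_ne hadj.ne with h | h <;> simp [hadj, hadj', h, h.not_gt]
  · have hadj' : ¬ P.G.graph.Adj k i := fun h => hadj h.symm
    simp [hadj, hadj']

/-- The phase is `(-1)^q` with `q(x) = ∑ x_i x_k` over the edges. The polar form of `q` is the
adjacency form, and `sum_byproductX` evaluates it on the X byproducts. -/
lemma edgePhase_add (κ : P.Keys) (ω : P.Outcomes) (w : V → ZMod 2) :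
    P.edgePhase Finset.univ (w + byproductX κ ω) =
      P.edgePhase Finset.univ (byproductX κ ω) * P.edgePhase Finset.univ w *
        ∏ k, bitPhase (w k * byproductZ κ ω k) := by
  classical
  have h : ∀ k, bitPhase (w k * byproductZ κ ω k) =
      ∏ l, if P.G.graph.Adj k l then bitPhase (w k * byproductX κ ω l) else 1 := by
    intro k
    rw [← sum_byproductX, Finset.mul_sum, bitPhase_sum]
    refine Finset.prod_congr rfl fun l _ => ?_
    split_ifs <;> simp
  simp only [h]
  rw [← prod_laterNbhd_symm]
  simp only [edgePhase, ← Finset.prod_mul_distrib]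
  refine Finset.prod_congr rfl fun i _ => Finset.prod_congr rfl fun k _ => ?_
  simp only [czPhase_eq, ← bitPhase_add, Pi.add_apply]
  congr 1
  ring

/-- The scalar picked up at node `i` when the byproducts are removed. -/
def siteScalar (φ : P.AliceAngles) (ψ : P.OscarAngles) (κ : P.Keys) (ω : P.Outcomes) (i : V) : ℂ :=
  bitPhase (byproductZ κ ω i * byproductX κ ω i) *
    if byproductX κ ω i = 1 then cis (nodeAngle φ ψ i) else 1

/-- At inputs the X byproduct is just `t_i`, so the translation undoes Alice's `X`. Elsewhere `|+⟩`
is invariant under bit flips. Only the phase of the random angle is left, to be absorbed by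
`finishOp_apply`. -/
lemma startOp_apply (κ : P.Keys) (α : P.AliceAngles) (β : P.OscarAngles) (ω : P.Outcomes)
    (x : P.G.I → ZMod 2) (i : V) (w : ZMod 2) :
    startOp κ α β i (w + byproductX κ ω i) (extendBits x i) =
      cis (nodeAngle α β i) ^ (w + byproductX κ ω i).val *
        if i ∈ P.G.I then if w = extendBits x i then 1 else 0 else plusKet 0 w := by
  unfold startOp
  by_cases hi : i ∈ P.G.I
  · simp only [hi, if_true, rotZ_mul_pauliX_apply, byproductX, invSignal_of_mem_I _ hi, zero_add,
      add_left_inj]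
  · simp [hi, Matrix.vecMulVec_apply, extendBits, zeroKet, plusKet_apply, mul_comm]

lemma finishOp_apply (φ : P.AliceAngles) (ψ : P.OscarAngles) (κ : P.Keys) (α : P.AliceAngles)
    (β : P.OscarAngles) (ω : P.Outcomes) (y : P.G.O → ZMod 2) (i : V) (w : ZMod 2) :
    finishOp φ ψ κ α β ω i (extendBits y i) (w + byproductX κ ω i) *
        cis (nodeAngle α β i) ^ (w + byproductX κ ω i).val =
      siteScalar φ ψ κ ω i * bitPhase (w * byproductZ κ ω i) *
        if i ∈ P.G.O then if w = extendBits y i then 1 else 0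
          else star (plusKet (nodeAngle φ ψ i) w) := by
  by_cases hi : i ∈ P.G.O
  -- Outputs carry no signal, so the byproduct is exactly the exponent of Alice's `Z` correction.
  · have hZ : byproductZ κ ω i = P.zSignal (signals κ ω) i + tSignal κ i := by
      simp [byproductZ, signals, hi]
    simp only [finishOp, hi, not_true_eq_false, dite_false, if_true, siteScalar,
      nodeAngle_of_mem_O _ _ hi, cis_zero, one_pow, mul_one, ite_self, ← hZ]
    change (pauliX ^ (byproductX κ ω i).val * pauliZ ^ (byproductZ κ ω i).val) _ _ = _
    have hxx : w + byproductX κ ω i + byproductX κ ω i = w := by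
      rw [add_assoc, CharTwo.add_self_eq_zero, add_zero]
    rw [pauliX_mul_pauliZ_apply, hxx, mul_add, bitPhase_add, mul_comm w]
    simp only [eq_comm (a := w)]
    ring
  · simp only [finishOp, hi, not_false_eq_true, dite_true, if_false, siteScalar]
    rw [Matrix.vecMulVec_apply, Pi.star_apply, plusKet_apply, cis_sentAngle _ _ _ _ _ _ hi,
      plusKet_apply, star_mul', star_mul', mul_assoc, mul_assoc, star_bitInv_pow_mul]
    simp only [extendBits, hi, dite_false, zeroKet, if_true]
    ring

/-- The Kraus operator of a branch of the protocol. -/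
def branchOp (φ : P.AliceAngles) (ψ : P.OscarAngles) (κ : P.Keys) (α : P.AliceAngles)
    (β : P.OscarAngles) (ω : P.Outcomes) : Matrix (P.G.O → ZMod 2) (P.G.I → ZMod 2) ℂ :=
  (embed P.G.O)ᴴ * commandsOp (run φ ψ κ α β ω).log * embed P.G.I

/-- The operator of the flow pattern before normalisation. -/
def patternOp (φ : P.AliceAngles) (ψ : P.OscarAngles) :
    Matrix (P.G.O → ZMod 2) (P.G.I → ZMod 2) ℂ :=
  P.braAll (nodeAngle φ ψ) * P.entangleAll * P.prepareAll

lemma branchOp_apply (φ : P.AliceAngles) (ψ : P.OscarAngles) (κ : P.Keys) (α : P.AliceAngles)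
    (β : P.OscarAngles) (ω : P.Outcomes) (y : P.G.O → ZMod 2) (x : P.G.I → ZMod 2) :
    branchOp φ ψ κ α β ω y x = ∑ w : V → ZMod 2,
      tensorOp (finishOp φ ψ κ α β ω) (extendBits y) w * P.edgePhase Finset.univ w *
        tensorOp (startOp κ α β) w (extendBits x) := by
  rw [branchOp, commandsOp_run_log, entangleAll_eq, mul_embed_apply,
    embed_conjTranspose_mul_apply, Matrix.mul_apply]
  simp only [Matrix.mul_diagonal]

/-- The scalar relating a branch of the protocol to the flow pattern. -/
def branchScalar (φ : P.AliceAngles) (ψ : P.OscarAngles) (κ : P.Keys) (ω : P.Outcomes) : ℂ :=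
  P.edgePhase Finset.univ (byproductX κ ω) * ∏ k, siteScalar φ ψ κ ω k

/-- After translating the summation variable by the X byproducts, the summands agree term by term up
to a factor independent of `w`, `x` and `y`. -/
theorem branchOp_eq (φ : P.AliceAngles) (ψ : P.OscarAngles) (κ : P.Keys) (α : P.AliceAngles)
    (β : P.OscarAngles) (ω : P.Outcomes) :
    branchOp φ ψ κ α β ω = branchScalar φ ψ κ ω • patternOp φ ψ := by
  ext y x
  rw [branchOp_apply, Matrix.smul_apply, patternOp, entangleAll_eq, Matrix.mul_apply,
    smul_eq_mul, Finset.mul_sum, ← Equiv.sum_comp (Equiv.addRight (byproductX κ ω))]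
  refine Finset.sum_congr rfl fun w _ => ?_
  rw [Matrix.mul_diagonal, braAll, prepareAll, prod_ite_mem_eq, prod_ite_mem_eq,
    Equiv.coe_addRight, edgePhase_add, branchScalar, tensorOp, tensorOp]
  simp only [Pi.add_apply, startOp_apply, Finset.prod_mul_distrib]
  have h := Finset.prod_congr (s₁ := (Finset.univ : Finset V)) rfl fun k _ =>
    finishOp_apply φ ψ κ α β ω y k (w k)
  simp only [Finset.prod_mul_distrib] at h
  -- This sign occurs once from the edges and once from the finishing operators; the two cancel.
  have hsq : (∏ k, bitPhase (w k * byproductZ κ ω k)) ^ 2 = 1 := by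
    rw [← bitPhase_sum, sq, ← bitPhase_add, CharTwo.add_self_eq_zero, bitPhase_zero]
  linear_combination (P.edgePhase Finset.univ (byproductX κ ω) * P.edgePhase Finset.univ w *
    (∏ k, bitPhase (w k * byproductZ κ ω k)) *
    ∏ k, if k ∈ P.G.I then if w k = extendBits x k then (1 : ℂ) else 0 else plusKet 0 (w k)) * h +
    P.edgePhase Finset.univ (byproductX κ ω) * P.edgePhase Finset.univ w *
      (∏ k, if k ∈ P.G.I then if w k = extendBits x k then (1 : ℂ) else 0 else plusKet 0 (w k)) *
      (∏ k, siteScalar φ ψ κ ω k) *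
      (∏ k, if k ∈ P.G.O then if w k = extendBits y k then 1 else 0
        else star (plusKet (nodeAngle φ ψ k) (w k))) * hsq

lemma norm_branchScalar (φ : P.AliceAngles) (ψ : P.OscarAngles) (κ : P.Keys) (ω : P.Outcomes) :
    ‖branchScalar φ ψ κ ω‖ = 1 := by
  rw [branchScalar, norm_mul, edgePhase, norm_prod, norm_prod]
  simp only [norm_prod, czPhase_eq, norm_bitPhase, Finset.prod_const_one, one_mul]
  refine Finset.prod_eq_one fun k _ => ?_
  rw [siteScalar, norm_mul, norm_bitPhase, one_mul]
  split_ifs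
  · exact norm_cis _
  · exact norm_one

end PublicInfo

/-! ### Adaptive measurements are complete -/

/-- The matrix is square, so orthonormality of its rows suffices, and the inner product of two rows
factors over sites. At the first site where `z` and `z'` differ both rows use the same unitary,
whose distinct rows are orthogonal. -/
lemma adaptive_isometry {V : Type*} [Fintype V] [LinearOrder V]
    (A : (V → ZMod 2) → V → Matrix (ZMod 2) (ZMod 2) ℂ) (hA : ∀ z k, A z k * (A z k)ᴴ = 1)
    (hdep : ∀ z z' k, (∀ j < k, z j = z' j) → A z k = A z' k) :
    (Matrix.of fun z v : V → ZMod 2 => ∏ k, A z k (z k) (v k))ᴴ *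
      (Matrix.of fun z v : V → ZMod 2 => ∏ k, A z k (z k) (v k)) = 1 := by
  rw [mul_eq_one_comm]
  ext z z'
  have h : ((Matrix.of fun z v : V → ZMod 2 => ∏ k, A z k (z k) (v k)) *
      (Matrix.of fun z v : V → ZMod 2 => ∏ k, A z k (z k) (v k))ᴴ) z z' =
      ∏ k, (A z k * (A z' k)ᴴ) (z k) (z' k) := by
    simp only [Matrix.mul_apply, Matrix.conjTranspose_apply, Matrix.of_apply, star_prod,
      ← Finset.prod_mul_distrib, Finset.prod_univ_sum, Fintype.piFinset_univ]
  rw [h]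
  by_cases hz : z = z'
  · subst hz; simp [hA]
  · rw [Matrix.one_apply_ne hz]
    have hne : (Finset.univ.filter fun k => z k ≠ z' k).Nonempty := by
      obtain ⟨k, hk⟩ := Function.ne_iff.1 hz
      exact ⟨k, by simpa using hk⟩
    have hmem := Finset.min'_mem _ hne
    refine Finset.prod_eq_zero (Finset.mem_univ (Finset.min' _ hne)) ?_
    rw [hdep z z', hA, Matrix.one_apply_ne (Finset.mem_filter.1 hmem).2]
    intro j hj
    by_contra hcon
    exact absurd (Finset.min'_le _ j (by simpa using hcon)) (not_le.2 hj)

lemma inv_sqrt_two_mul_self :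
    ((1 / Real.sqrt 2 : ℝ) : ℂ) * ((1 / Real.sqrt 2 : ℝ) : ℂ) = 1 / 2 := by
  rw [← Complex.ofReal_mul, div_mul_div_comm, Real.mul_self_sqrt (by norm_num)]
  norm_num

/-- The measurement in the basis `|±_δ⟩`, as a change of basis. -/
lemma plusBasis_mul_conjTranspose (δ : ℝ) :
    (Matrix.of fun s v : ZMod 2 => star (plusKet (δ + (s.val : ℝ) * Real.pi) v)) *
      (Matrix.of fun s v : ZMod 2 => star (plusKet (δ + (s.val : ℝ) * Real.pi) v))ᴴ = 1 := by
  have h0 := inv_sqrt_two_mul_self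
  have h1 := cis_ne_zero δ
  ext s s'
  simp only [Matrix.mul_apply, sum_bit, Matrix.conjTranspose_apply, Matrix.of_apply, star_star,
    plusKet_apply, cis_add, cis_bit_mul_pi]
  have hr : star ((1 / Real.sqrt 2 : ℝ) : ℂ) = ((1 / Real.sqrt 2 : ℝ) : ℂ) :=
    Complex.conj_ofReal _
  have hb : ∀ a, star (bitPhase a) = bitPhase a := fun a => by
    rcases bit_cases a with rfl | rfl <;> simp
  simp only [star_mul', hr, ZMod.val_zero, pow_zero, star_one, bit_val_one, pow_one, star_cis, hb]
  have e : ∀ b b' r : ℂ, r * r = 1 / 2 → r * 1 * (r * 1) +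
      r * ((cis δ)⁻¹ * b) * (r * (cis δ * b')) = 1 / 2 * (1 + b * b') := by
    intro b b' r hr
    rw [← hr]
    field_simp
  rw [e _ _ _ h0]
  rcases bit_cases s with rfl | rfl <;> rcases bit_cases s' with rfl | rfl <;> norm_num

lemma pauliX_mul_pauliZ_mul_conjTranspose (a b : ZMod 2) :
    (pauliX ^ a.val * pauliZ ^ b.val) * (pauliX ^ a.val * pauliZ ^ b.val)ᴴ = 1 := by
  ext y y'
  simp only [Matrix.mul_apply (M := pauliX ^ a.val * pauliZ ^ b.val), sum_bit,
    Matrix.conjTranspose_apply, pauliX_mul_pauliZ_apply]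
  rcases bit_cases a with rfl | rfl <;> rcases bit_cases b with rfl | rfl <;>
    rcases bit_cases y with rfl | rfl <;> rcases bit_cases y' with rfl | rfl <;>
    simp [bit_one_add_one]

lemma conjTranspose_mul_rotZ_mul_pauliX (θ : ℝ) (t : ZMod 2) :
    (rotZ θ * pauliX ^ t.val)ᴴ * (rotZ θ * pauliX ^ t.val) = 1 := by
  have h1 := cis_ne_zero θ
  ext x x'
  simp only [Matrix.mul_apply (N := rotZ θ * pauliX ^ t.val), sum_bit,
    Matrix.conjTranspose_apply, rotZ_mul_pauliX_apply, star_mul', star_pow, star_cis]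
  rcases bit_cases t with rfl | rfl <;> rcases bit_cases x with rfl | rfl <;>
    rcases bit_cases x' with rfl | rfl <;>
    simp [bit_one_add_one, bit_val_one, h1]

lemma star_plusKet_mul_plusKet (θ : ℝ) :
    star (plusKet θ 0) * plusKet θ 0 + star (plusKet θ 1) * plusKet θ 1 = 1 := by
  have h0 := inv_sqrt_two_mul_self
  have h1 := cis_ne_zero θ
  have hr : star ((1 / Real.sqrt 2 : ℝ) : ℂ) = ((1 / Real.sqrt 2 : ℝ) : ℂ) :=
    Complex.conj_ofReal _
  simp only [plusKet_apply, star_mul', hr, ZMod.val_zero, pow_zero, star_one, bit_val_one,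
    pow_one, star_cis]
  have e : ∀ r : ℂ, r * r = 1 / 2 →
      r * 1 * (r * 1) + r * (cis θ)⁻¹ * (r * cis θ) = 1 := by
    intro r hr
    have : r * 1 * (r * 1) + r * (cis θ)⁻¹ * (r * cis θ) = 2 * (r * r) := by
      field_simp; ring
    rw [this, hr]; norm_num
  exact e _ h0

namespace PublicInfo

variable {V : Type*} [Fintype V] [LinearOrder V] {P : PublicInfo V}

/-- The operator that finishes the round of node `i`, with one row for each measurement outcome
if `i` is measured; the outcomes of the other nodes are read off from `z`. -/
def outcomeOp (φ : P.AliceAngles) (ψ : P.OscarAngles) (κ : P.Keys) (α : P.AliceAngles)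
    (β : P.OscarAngles) (z : V → ZMod 2) (i : V) : Matrix (ZMod 2) (ZMod 2) ℂ :=
  if i ∉ P.G.O then
    Matrix.of fun s v =>
      star (plusKet (sentAngle φ ψ κ α β (fun j => z j) i + (s.val : ℝ) * Real.pi) v)
  else pauliX ^ (P.invSignal (signals κ fun j => z j) i + keyT κ i).val *
    pauliZ ^ (P.zSignal (signals κ fun j => z j) i + tSignal κ i).val

lemma outcomeOp_congr (φ : P.AliceAngles) (ψ : P.OscarAngles) (κ : P.Keys) (α : P.AliceAngles)
    (β : P.OscarAngles) (z z' : V → ZMod 2) (i : V) (h : ∀ j < i, z j = z' j) :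
    outcomeOp φ ψ κ α β z i = outcomeOp φ ψ κ α β z' i := by
  have hs : ∀ j < i, signals κ (fun k => z k : P.Outcomes) j =
      signals κ (fun k => z' k : P.Outcomes) j := by
    intro j hj
    simp [signals, h j hj]
  have hd : sentAngle φ ψ κ α β (fun j => z j) i = sentAngle φ ψ κ α β (fun j => z' j) i := by
    unfold sentAngle
    split_ifs
    · exact delta_congr _ _ rfl hs
    · exact delta_congr _ _ rfl hs
  simp only [outcomeOp, hd, invSignal_congr hs, zSignal_congr hs]

lemma outcomeOp_mul_conjTranspose (φ : P.AliceAngles) (ψ : P.OscarAngles) (κ : P.Keys)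
    (α : P.AliceAngles) (β : P.OscarAngles) (z : V → ZMod 2) (i : V) :
    outcomeOp φ ψ κ α β z i * (outcomeOp φ ψ κ α β z i)ᴴ = 1 := by
  unfold outcomeOp
  split_ifs
  · exact pauliX_mul_pauliZ_mul_conjTranspose _ _
  · exact plusBasis_mul_conjTranspose _

/-- A measured site is reset to `|0⟩` with its outcome kept as a parameter; here the outcome becomes
the row index instead, so that all branches form one square matrix. -/
lemma finishOp_extendBits (φ : P.AliceAngles) (ψ : P.OscarAngles) (κ : P.Keys)
    (α : P.AliceAngles) (β : P.OscarAngles) (z : V → ZMod 2) (i : V) (v : ZMod 2) :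
    finishOp φ ψ κ α β (fun j => z j) i (extendBits (S := P.G.O) (fun j => z j) i) v =
      outcomeOp φ ψ κ α β z i (z i) v := by
  by_cases hi : i ∈ P.G.O
  · simp [finishOp, outcomeOp, extendBits, hi]
  · simp only [finishOp, outcomeOp, hi, not_false_eq_true, dite_true, if_true,
      Matrix.vecMulVec_apply, extendBits, dite_false, zeroKet, one_mul, Matrix.of_apply,
      Pi.star_apply]

/-- The preparation of all qubits, from the input, is an isometry. -/
lemma start_isometry (κ : P.Keys) (α : P.AliceAngles) (β : P.OscarAngles) :
    (tensorOp (startOp κ α β) * embed P.G.I)ᴴ * (tensorOp (startOp κ α β) * embed P.G.I) = 1 := by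
  ext x x'
  have hsite : ∀ k, ((startOp κ α β k)ᴴ * startOp κ α β k) (extendBits x k) (extendBits x' k) =
      if extendBits x k = extendBits x' k then 1 else 0 := by
    intro k
    by_cases hk : k ∈ P.G.I
    · simp only [startOp, hk, if_true, conjTranspose_mul_rotZ_mul_pauliX, Matrix.one_apply]
    · simp only [startOp, hk, if_false, extendBits, dite_false, if_true, Matrix.mul_apply,
        sum_bit, Matrix.conjTranspose_apply, Matrix.vecMulVec_apply, Pi.star_apply, zeroKet,
        star_one, mul_one]
      exact star_plusKet_mul_plusKet _
  have h : ((tensorOp (startOp κ α β) * embed P.G.I)ᴴ *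
      (tensorOp (startOp κ α β) * embed P.G.I)) x x' =
      ∏ k, ((startOp κ α β k)ᴴ * startOp κ α β k) (extendBits x k) (extendBits x' k) := by
    rw [Matrix.mul_apply]
    simp only [Matrix.conjTranspose_apply, mul_embed_apply]
    simp only [tensorOp, star_prod, ← Finset.prod_mul_distrib, Matrix.mul_apply,
      Matrix.conjTranspose_apply, Finset.prod_univ_sum, Fintype.piFinset_univ]
  rw [h, Finset.prod_congr rfl fun k _ => hsite k, Finset.prod_ite_zero, Matrix.one_apply]
  have hiff : (∀ k ∈ Finset.univ, extendBits x k = extendBits x' k) ↔ x = x' := by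
    refine ⟨fun h => ?_, fun h => by simp [h]⟩
    ext1 k
    simpa [extendBits] using h k (Finset.mem_univ _)
  simp only [hiff, Finset.prod_const_one]

lemma entangleAll_isometry : (P.entangleAll)ᴴ * P.entangleAll = 1 := by
  rw [entangleAll_eq, Matrix.diagonal_conjTranspose, Matrix.diagonal_mul_diagonal,
    ← Matrix.diagonal_one]
  congr 1
  ext1 w
  have : ‖P.edgePhase Finset.univ w‖ = 1 := by
    simp [edgePhase, norm_prod, czPhase_eq, norm_bitPhase]
  rw [Pi.star_apply]
  change (starRingEnd ℂ) _ * _ = 1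
  rw [Complex.conj_mul', this]
  norm_num

/-- The probabilities of the branches of the protocol add up to one. -/
theorem sum_branchOp (φ : P.AliceAngles) (ψ : P.OscarAngles) (κ : P.Keys)
    (α : P.AliceAngles) (β : P.OscarAngles) :
    ∑ ω : P.Outcomes, (branchOp φ ψ κ α β ω)ᴴ * branchOp φ ψ κ α β ω = 1 := by
  set T : Matrix (V → ZMod 2) (V → ZMod 2) ℂ :=
    Matrix.of fun z v => ∏ k, outcomeOp φ ψ κ α β z k (z k) (v k) with hT
  set R := tensorOp (startOp κ α β) * embed P.G.I with hR
  have hTT : Tᴴ * T = 1 := adaptive_isometry _ (outcomeOp_mul_conjTranspose φ ψ κ α β)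
    (outcomeOp_congr φ ψ κ α β)
  have hN : (T * P.entangleAll * R)ᴴ * (T * P.entangleAll * R) = 1 := by
    calc (T * P.entangleAll * R)ᴴ * (T * P.entangleAll * R)
        = Rᴴ * ((P.entangleAll)ᴴ * (Tᴴ * T) * P.entangleAll) * R := by
          simp only [Matrix.conjTranspose_mul, Matrix.mul_assoc]
      _ = 1 := by
          rw [hTT, Matrix.mul_one, entangleAll_isometry, Matrix.mul_one, hR, start_isometry]
  -- A bit string `z` on all nodes encodes an outcome string together with an output basis state;
  -- the sum over `z` is split accordingly below.
  have hK : ∀ (z : V → ZMod 2) (x : P.G.I → ZMod 2),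
      branchOp φ ψ κ α β (fun j => z j) (fun j => z j) x = (T * P.entangleAll * R) z x := by
    intro z x
    rw [branchOp_apply, entangleAll_eq, Matrix.mul_apply]
    refine Finset.sum_congr rfl fun w _ => ?_
    rw [Matrix.mul_diagonal, hR, mul_embed_apply]
    simp only [tensorOp, hT, Matrix.of_apply, finishOp_extendBits]
  rw [← hN]
  ext x x'
  rw [Matrix.sum_apply, Matrix.mul_apply,
    ← (Equiv.piEquivPiSubtypeProd (fun i => i ∈ P.G.O) fun _ => ZMod 2).symm.sum_comp,
    Fintype.sum_prod_type_right]
  refine Finset.sum_congr rfl fun ω _ => ?_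
  rw [Matrix.mul_apply]
  refine Finset.sum_congr rfl fun y _ => ?_
  set z := (Equiv.piEquivPiSubtypeProd (fun i => i ∈ P.G.O) fun _ => ZMod 2).symm (y, ω) with hz
  have hω : (fun j => z j : P.Outcomes) = ω := by
    ext1 j
    simp [hz, Equiv.piEquivPiSubtypeProd, j.2]
  have hy : (fun j => z j : P.G.O → ZMod 2) = y := by
    ext1 j
    simp [hz, Equiv.piEquivPiSubtypeProd]
  rw [Matrix.conjTranspose_apply, Matrix.conjTranspose_apply, ← hK z, ← hK z, hω, hy]

theorem patternOp_isometry (φ : P.AliceAngles) (ψ : P.OscarAngles) :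
    (2 : ℂ) ^ (P.G.Oᶜ).card • ((patternOp φ ψ)ᴴ * patternOp φ ψ) = 1 := by
  -- Any keys and random angles would do; `0`, `φ` and `ψ` are simply at hand.
  rw [← sum_branchOp φ ψ 0 φ ψ]
  have hω : ∀ ω : P.Outcomes, (branchOp φ ψ 0 φ ψ ω)ᴴ * branchOp φ ψ 0 φ ψ ω =
      (patternOp φ ψ)ᴴ * patternOp φ ψ := by
    intro ω
    have : star (branchScalar φ ψ 0 ω) * branchScalar φ ψ 0 ω = 1 := by
      change (starRingEnd ℂ) _ * _ = 1
      rw [Complex.conj_mul', norm_branchScalar]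
      norm_num
    rw [branchOp_eq, Matrix.conjTranspose_smul, Matrix.smul_mul, Matrix.mul_smul, smul_smul, this,
      one_smul]
  rw [Finset.sum_congr rfl fun ω _ => hω ω, Finset.sum_const, ← Nat.cast_smul_eq_nsmul ℂ]
  congr 1
  simp [Finset.card_compl]

/-! ### Normalisation, and averaging over branches -/

lemma isometry_eq (φ : P.AliceAngles) (ψ : P.OscarAngles) :
    isometry φ ψ = ((Real.sqrt 2 : ℝ) : ℂ) ^ (P.G.Oᶜ).card • patternOp φ ψ := rfl

lemma star_sqrt_two_pow_mul (n : ℕ) :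
    ((Real.sqrt 2 : ℝ) : ℂ) ^ n * star (((Real.sqrt 2 : ℝ) : ℂ) ^ n) = 2 ^ n := by
  have hr : star ((Real.sqrt 2 : ℝ) : ℂ) = ((Real.sqrt 2 : ℝ) : ℂ) := Complex.conj_ofReal _
  rw [star_pow, hr, ← mul_pow, ← Complex.ofReal_mul, Real.mul_self_sqrt (by norm_num)]
  norm_num

theorem isometry_conjTranspose_mul (φ : P.AliceAngles) (ψ : P.OscarAngles) :
    (isometry φ ψ)ᴴ * isometry φ ψ = 1 := by
  rw [isometry_eq, Matrix.conjTranspose_smul, Matrix.smul_mul, Matrix.mul_smul, smul_smul,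
    mul_comm, star_sqrt_two_pow_mul, patternOp_isometry]

/-- The branch scalar has modulus one and cancels under conjugation; the remaining factor offsets
the two powers of `√2` in the normalised operator. -/
theorem branchOutput_eq (φ : P.AliceAngles) (ψ : P.OscarAngles) (κ : P.Keys) (α : P.AliceAngles)
    (β : P.OscarAngles) (ω : P.Outcomes) (ρ : Matrix (P.G.I → ZMod 2) (P.G.I → ZMod 2) ℂ) :
    branchOutput φ ψ κ α β ω ρ =
      ((1 : ℂ) / 2) ^ (P.G.Oᶜ).card • (isometry φ ψ * ρ * (isometry φ ψ)ᴴ) := by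
  change branchOp φ ψ κ α β ω * ρ * (branchOp φ ψ κ α β ω)ᴴ = _
  have h1 : branchScalar φ ψ κ ω * star (branchScalar φ ψ κ ω) = 1 := by
    change _ * (starRingEnd ℂ) _ = 1
    rw [Complex.mul_conj', norm_branchScalar]
    norm_num
  simp only [branchOp_eq, isometry_eq, Matrix.conjTranspose_smul, Matrix.smul_mul,
    Matrix.mul_smul, smul_smul, mul_comm (star _), h1, star_sqrt_two_pow_mul]
  rw [← mul_pow]
  norm_num

theorem protocolOutput_eq (φ : P.AliceAngles) (ψ : P.OscarAngles)
    (ρ : Matrix (P.G.I → ZMod 2) (P.G.I → ZMod 2) ℂ) :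
    protocolOutput φ ψ ρ = isometry φ ψ * ρ * (isometry φ ψ)ᴴ := by
  have hne : (Fintype.card (P.Keys × P.AliceAngles × P.OscarAngles) : ℂ) ≠ 0 := by
    -- The given angles themselves show that the sample space of the average is nonempty.
    have : Nonempty (P.Keys × P.AliceAngles × P.OscarAngles) := ⟨(0, φ, ψ)⟩
    exact Nat.cast_ne_zero.2 Fintype.card_ne_zero
  have hcard : Fintype.card P.Outcomes = 2 ^ (P.G.Oᶜ).card := by
    simp [Finset.card_compl]
  simp only [protocolOutput, branchOutput_eq, Finset.sum_const, Finset.card_univ, hcard]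
  rw [← Nat.cast_smul_eq_nsmul ℂ, ← Nat.cast_smul_eq_nsmul ℂ, smul_smul, smul_smul, smul_smul,
    inv_mul_cancel₀ hne, one_mul]
  push_cast
  rw [← mul_pow]
  norm_num

end PublicInfo

end BOQCo

end

theorem mainTheorem5 {V : Type*} [Fintype V] [LinearOrder V] (P : BOQCo.PublicInfo V)
    (φ : P.AliceAngles) (ψ : P.OscarAngles) :
    -- the operator of the flow pattern is an isometry
    (BOQCo.PublicInfo.isometry φ ψ)ᴴ * BOQCo.PublicInfo.isometry φ ψ = 1 ∧
    -- Alice's output is the image of her input under this isometry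
    (∀ ρ : Matrix (P.G.I → ZMod 2) (P.G.I → ZMod 2) ℂ,
      BOQCo.PublicInfo.protocolOutput φ ψ ρ =
        BOQCo.PublicInfo.isometry φ ψ * ρ * (BOQCo.PublicInfo.isometry φ ψ)ᴴ) ∧
    -- for all keys, random angles and measurement outcomes, the run is executable, it ends with
    -- Alice holding exactly the output qubits, and the output is the same
    (∀ (κ : P.Keys) (α : P.AliceAngles) (β : P.OscarAngles) (ω : P.Outcomes),
      BOQCo.execAll (BOQCo.heldByAlice P.G.I) (BOQCo.PublicInfo.run φ ψ κ α β ω).log =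
        some (BOQCo.heldByAlice P.G.O) ∧
      ∀ ρ : Matrix (P.G.I → ZMod 2) (P.G.I → ZMod 2) ℂ,
        BOQCo.PublicInfo.branchOutput φ ψ κ α β ω ρ =
          ((1 : ℂ) / 2) ^ (P.G.Oᶜ).card •
            (BOQCo.PublicInfo.isometry φ ψ * ρ * (BOQCo.PublicInfo.isometry φ ψ)ᴴ)) ∧
    -- Alice and Oscar never send anything to each other
    (∀ (κ : P.Keys) (α : P.AliceAngles) (β : P.OscarAngles) (ω : P.Outcomes),
      ∀ c ∈ (BOQCo.PublicInfo.run φ ψ κ α β ω).log,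
        ¬ (c.actor = .alice ∧ c.receiver = some .oscar) ∧
        ¬ (c.actor = .oscar ∧ c.receiver = some .alice)) ∧
    -- given the keys and the outcomes announced by Bob, Alice's actions do not depend on Oscar's
    -- computation and random angles, and Oscar's do not depend on Alice's
    (∀ (κ : P.Keys) (α : P.AliceAngles) (β : P.OscarAngles) (ω : P.Outcomes),
      (∀ ψ' β' : P.OscarAngles,
        (BOQCo.PublicInfo.run φ ψ κ α β ω).log.filter (fun c => c.actor = .alice) =
          (BOQCo.PublicInfo.run φ ψ' κ α β' ω).log.filter (fun c => c.actor = .alice)) ∧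
      (∀ φ' α' : P.AliceAngles,
        (BOQCo.PublicInfo.run φ ψ κ α β ω).log.filter (fun c => c.actor = .oscar) =
          (BOQCo.PublicInfo.run φ' ψ κ α' β ω).log.filter (fun c => c.actor = .oscar))) := by
  refine ⟨BOQCo.PublicInfo.isometry_conjTranspose_mul φ ψ,
    BOQCo.PublicInfo.protocolOutput_eq φ ψ,
    fun κ α β ω => ⟨BOQCo.PublicInfo.execAll_run_log φ ψ κ α β ω,
      BOQCo.PublicInfo.branchOutput_eq φ ψ κ α β ω⟩,
    BOQCo.PublicInfo.alice_oscar_silent φ ψ,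
    fun κ α β ω => ⟨fun ψ' β' => BOQCo.PublicInfo.alice_log_independent φ ψ ψ' κ α β β' ω,
      fun φ' α' => BOQCo.PublicInfo.oscar_log_independent φ φ' ψ κ α α' β ω⟩⟩
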